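/- Let $\mathbb U$ be the Urysohn space (the complete separable metric space in which every one-point metric extension of a finite subset is realized), and let $F(\mathbb U)$ be the set of its nonempty closed subsets with the Effros Borel structure. For a countable set $D\subseteq[0,\infty)$ with $0\in D$, let $\mathcal U_D\subseteq F(\mathbb U)$ be the set of those $U$ on which the metric is an ultrametric and all of whose distances lie in $D$, and let $\mathcal U^\star_D\subseteq\mathcal U_D$ be the set of those $U$ whose set of realized distances is exactly $D$. Let graph isomorphism be the isomorphism relation on the space of all (simple) graphs with vertex set $\mathbb N$. Suppose that $D$ contains a strictly decreasing sequence $(r_n)_{n\in\mathbb N}$. Then: 1. The relation of isometry on $\mathcal U_D$ is Borel bireducible with graph isomorphism. 2. The relation of isometry on $\mathcal U^\star_D$ is Borel bireducible with graph isomorphism. 3. Suppose moreover that $r_n\to r$ with $r>0$. Let $\mathrm{RCT}$ be the space of rooted combinatorial trees on $\mathbb N$ (connected acyclic graphs with vertex set $\mathbb N$ and a distinguished vertex, the root). On the set $\mathbb N^{<\mathbb N}$ of finite sequences consider the distance with $d(s,s)=0$ and, for $s\ne t$, $d(s,t)=r_n$ for the greatest $n$ such that $s\restriction n=t\restriction n$.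 There is an isometric embedding of $(\mathbb N^{<\mathbb N},d)$ into $\mathbb U$. Fix any such embedding $\rho$. For $G\in\mathrm{RCT}$ let $G'\subseteq\mathbb N^{<\mathbb N}$ be the set of all sequences $(v_1,\dots,v_n)$ such that $(\text{root},v_1,\dots,v_n)$ is a path without repetitions in $G$ (so $G'$ is a copy of $G$ with root $\emptyset$, in which adjacency is extension by one entry). Then $\theta(G)=\rho[G']$ defines a Borel map $\theta\colon\mathrm{RCT}\to\mathcal U_D$ such that, for all $G,H\in\mathrm{RCT}$, $G$ and $H$ are isomorphic if and only if $\theta(G)$ and $\theta(H)$ are isometric, and $G$ embeds into $H$ if and only if $\theta(G)$ embeds isometrically into $\theta(H)$. Here isomorphisms and embeddings of rooted trees preserve adjacency in both directions and send the root to the root. -/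

import Mathlib

open Filter Topology

noncomputable section

/-! ### The Urysohn space -/

/-- The finite extension property: every one-point metric extension of a finite subset of `X` is
realised in `X`. Such an extension of `A` is given by the function `f` of the distances to the new
point, which satisfies `|f a - f b| ≤ d(a, b) ≤ f a + f b`. -/
def HasUrysohnProperty (X : Type*) [MetricSpace X] : Prop :=
  ∀ (A : Finset X) (f : X → ℝ),
    (∀ a ∈ A, ∀ b ∈ A, |f a - f b| ≤ dist a b ∧ dist a b ≤ f a + f b) →
    ∃ x : X, ∀ a ∈ A, dist x a = f a

/-- `X` is a Urysohn space: a complete separable metric space with the finite extension property.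
Up to isometry there is exactly one such space. -/
structure IsUrysohn (X : Type*) [MetricSpace X] : Prop where
  complete : CompleteSpace X
  separable : TopologicalSpace.SeparableSpace X
  extension : HasUrysohnProperty X

namespace UrysohnConstruction

/-- `D` is a pseudometric on `ℕ`. -/
structure IsPM (D : ℕ → ℕ → ℝ) : Prop where
  self : ∀ i, D i i = 0
  symm : ∀ i j, D i j = D j i
  tri : ∀ i j k, D i k ≤ D i j + D j k

/-- The function `i ↦ min_{j ≤ m} (q j + D j i)`. -/
def katMin (D : ℕ → ℕ → ℝ) (m : ℕ) (q : ℕ → ℝ) (i : ℕ) : ℝ :=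
  (Finset.range (m + 1)).inf' ⟨0, by simp⟩ (fun j => q j + D j i)

open Classical in
/-- Move the point `n` so that its distance to `i` becomes `katMin D m q i`, if the prescribed
distances `q` to the points `0, …, m` are admissible. -/
def step (D : ℕ → ℕ → ℝ) (n m : ℕ) (q : ℕ → ℝ) : ℕ → ℕ → ℝ :=
  if ∀ j ≤ m, ∀ l ≤ m, D j l ≤ q j + q l then
    fun i k => if i = n then (if k = n then 0 else katMin D m q k)
      else (if k = n then katMin D m q i else D i k)
  else D

/-- An enumeration, with infinite repetitions, of the lists of prescribed rational distances. -/
def code (n : ℕ) : ℕ × List ℚ := (Denumerable.eqv (ℕ × List ℚ)).symm n.unpair.1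

def coef (n j : ℕ) : ℝ := ((code n).2.getD j 0 : ℚ)

/-- Pseudometrics on `ℕ`; at stage `n` the position of the point `n` is fixed. -/
def stage : ℕ → ℕ → ℕ → ℝ
  | 0 => fun _ _ => 0
  | n + 1 => step (stage n) n (code n).1 (coef n)

/-- The limit pseudometric. -/
def limDist (i j : ℕ) : ℝ := stage (max i j + 1) i j

theorem katMin_le {D m q i j} (hj : j ≤ m) : katMin D m q i ≤ q j + D j i :=
  Finset.inf'_le (fun j => q j + D j i) (by simp; omega)

theorem exists_katMin (D m q i) : ∃ j ≤ m, katMin D m q i = q j + D j i := by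
  obtain ⟨j, hj, h⟩ := Finset.exists_mem_eq_inf' (s := Finset.range (m + 1)) ⟨0, by simp⟩
    (fun j => q j + D j i)
  exact ⟨j, by simp at hj; omega, h⟩

theorem IsPM.step {D : ℕ → ℕ → ℝ} (h : IsPM D) (n m q) : IsPM (step D n m q) := by
  unfold UrysohnConstruction.step
  split_ifs with hq
  swap
  · exact h
  have lip : ∀ i k, katMin D m q i ≤ katMin D m q k + D k i := by
    intro i k
    obtain ⟨j, hj, e⟩ := exists_katMin D m q k
    have := katMin_le (D := D) (q := q) (i := i) hj
    have := h.tri j k i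
    linarith
  have add : ∀ i k, D i k ≤ katMin D m q i + katMin D m q k := by
    intro i k
    obtain ⟨j, hj, e⟩ := exists_katMin D m q i
    obtain ⟨l, hl, e'⟩ := exists_katMin D m q k
    have := hq j hj l hl
    have := h.tri i j k
    have := h.tri j l k
    have := h.symm i j
    linarith
  have pos : ∀ i, 0 ≤ katMin D m q i := by
    intro i
    have := add i i
    have := h.self i
    linarith
  refine ⟨?_, ?_, ?_⟩
  · intro i
    by_cases hi : i = n <;> simp [hi, h.self]
  · intro i j
    by_cases hi : i = n <;> by_cases hj : j = n <;> simp [hi, hj, h.symm i j]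
  · intro i j k
    have h1 := lip i j
    have h2 := lip k j
    have h3 := add i k
    have h4 := pos i
    have h5 := pos j
    have h6 := pos k
    have h7 := h.tri i j k
    have h8 := h.symm i j
    have h9 := lip i k
    have h10 := lip k i
    by_cases hi : i = n <;> by_cases hj : j = n <;> by_cases hk : k = n <;>
      simp [hi, hj, hk] <;> linarith

theorem isPM_stage (n : ℕ) : IsPM (stage n) := by
  induction n with
  | zero => exact ⟨fun _ => rfl, fun _ _ => rfl, fun _ _ _ => by simp [stage]⟩
  | succ n ih => exact ih.step _ _ _

theorem stage_succ_of_ne {n i j : ℕ} (hi : i ≠ n) (hj : j ≠ n) :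
    stage (n + 1) i j = stage n i j := by
  simp only [stage, step]
  split_ifs <;> simp [hi, hj]

theorem stage_eq {i j n : ℕ} (h : max i j + 1 ≤ n) : stage n i j = limDist i j := by
  induction n, h using Nat.le_induction with
  | base => rfl
  | succ n hn ih => rw [stage_succ_of_ne (by omega) (by omega), ih]

theorem isPM_limDist : IsPM limDist := by
  refine ⟨fun i => (isPM_stage _).self i, fun i j => ?_, fun i j k => ?_⟩
  · rw [limDist, limDist, max_comm]; exact (isPM_stage _).symm i j
  · rw [← stage_eq (n := i + j + k + 1) (by omega), ← stage_eq (n := i + j + k + 1) (by omega),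
      ← stage_eq (n := i + j + k + 1) (by omega)]
    exact (isPM_stage _).tri i j k

theorem limDist_approx (m : ℕ) (f : ℕ → ℝ) (hf : ∀ i ≤ m, ∀ j ≤ m,
    f i ≤ f j + limDist j i ∧ limDist i j ≤ f i + f j) (ε : ℝ) (hε : 0 < ε) :
    ∃ n, ∀ j ≤ m, f j ≤ limDist n j ∧ limDist n j ≤ f j + ε := by
  have hq : ∀ j, ∃ q : ℚ, f j < q ∧ (q : ℝ) < f j + ε := fun j => exists_rat_btwn (by linarith)
  choose q hq1 hq2 using hq
  set l : List ℚ := (List.range (m + 1)).map q with hl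
  set n := Nat.pair (Denumerable.eqv (ℕ × List ℚ) (m, l)) (m + 1) with hn
  have hmn : m < n := by
    have := Nat.right_le_pair (Denumerable.eqv (ℕ × List ℚ) (m, l)) (m + 1)
    omega
  have hcode : code n = (m, l) := by simp only [code, hn, Nat.unpair_pair, Equiv.symm_apply_apply]
  have hcoef : ∀ j ≤ m, coef n j = q j := by
    intro j hj
    simp only [coef, hcode, hl]
    rw [List.getD_eq_getElem _ _ (by simp; omega)]
    simp
  have hst : ∀ i ≤ m, ∀ j ≤ m, stage n i j = limDist i j := fun i hi j hj =>
    stage_eq (by omega)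
  refine ⟨n, fun j hj => ?_⟩
  have e : limDist n j = katMin (stage n) m (coef n) j := by
    rw [← stage_eq (n := n + 1) (by omega)]
    simp only [stage, step, hcode]
    rw [if_pos]
    · simp [show j ≠ n by omega]
    · intro a ha b hb
      rw [hst a ha b hb, hcoef a ha, hcoef b hb]
      have := (hf a ha b hb).2
      have := hq1 a
      have := hq1 b
      linarith
  rw [e]
  constructor
  · obtain ⟨a, ha, e'⟩ := exists_katMin (stage n) m (coef n) j
    rw [e', hst a ha j hj, hcoef a ha]
    have := (hf j hj a ha).1
    have := hq1 a
    linarith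
  · have := katMin_le (D := stage n) (q := coef n) (i := j) hj
    rw [hst j hj j hj, hcoef j hj, isPM_limDist.self] at this
    have := hq2 j
    linarith

/-- The natural numbers with the pseudometric `limDist`. -/
def Pre : Type := ℕ

instance : PseudoMetricSpace Pre where
  dist i j := limDist i j
  dist_self := isPM_limDist.self
  dist_comm := isPM_limDist.symm
  dist_triangle := isPM_limDist.tri

instance : Countable Pre := inferInstanceAs (Countable ℕ)

end UrysohnConstruction

/-- The Urysohn space, as the completion of a countable space in which all one-point extensions of
finite subspaces with rational distances are added one after another. -/
abbrev UrysohnSpace : Type := UniformSpace.Completion UrysohnConstruction.Pre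

namespace UrysohnConstruction

/-- The dense sequence of the points of the construction. -/
def pt (n : ℕ) : UrysohnSpace := UniformSpace.Completion.coe' (α := Pre) n

theorem dist_pt (i j : ℕ) : dist (pt i) (pt j) = limDist i j :=
  UniformSpace.Completion.dist_eq (α := Pre) i j

theorem exists_pt (x : UrysohnSpace) {ε : ℝ} (hε : 0 < ε) : ∃ n, dist x (pt n) < ε :=
  (UniformSpace.Completion.denseRange_coe (α := Pre)).exists_dist_lt x hε

theorem approx {ι : Type} [Fintype ι] (p : ι → UrysohnSpace) (f : ι → ℝ)
    (hf : ∀ a b, |f a - f b| ≤ dist (p a) (p b) ∧ dist (p a) (p b) ≤ f a + f b)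
    (ε : ℝ) (hε : 0 < ε) : ∃ x : UrysohnSpace, ∀ a, |dist x (p a) - f a| ≤ ε := by
  rcases isEmpty_or_nonempty ι with h | h
  · exact ⟨pt 0, fun a => h.elim a⟩
  have hd : ∀ a, ∃ n : ℕ, dist (p a) (pt n) < ε / 4 := fun a => exists_pt _ (by linarith)
  choose n hn using hd
  set F : UrysohnSpace → ℝ := fun y =>
    Finset.univ.inf' Finset.univ_nonempty (fun a => f a + dist (p a) y) with hF
  have F_le : ∀ y a, F y ≤ f a + dist (p a) y := fun y a =>
    Finset.inf'_le (fun a => f a + dist (p a) y) (Finset.mem_univ a)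
  have F_ex : ∀ y, ∃ a, F y = f a + dist (p a) y := fun y => by
    obtain ⟨a, -, e⟩ := Finset.exists_mem_eq_inf' (s := Finset.univ) Finset.univ_nonempty
      (fun a => f a + dist (p a) y)
    exact ⟨a, e⟩
  have F_p : ∀ a, F (p a) = f a := by
    intro a
    apply le_antisymm
    · simpa using F_le (p a) a
    · obtain ⟨b, e⟩ := F_ex (p a)
      have := (abs_le.1 (hf b a).1).1
      linarith
  have F_lip : ∀ y z, F y ≤ F z + dist z y := by
    intro y z
    obtain ⟨a, e⟩ := F_ex z
    have := F_le y a
    have := dist_triangle (p a) z y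
    linarith
  have F_add : ∀ y z, dist y z ≤ F y + F z := by
    intro y z
    obtain ⟨a, e⟩ := F_ex y
    obtain ⟨b, e'⟩ := F_ex z
    have := (hf a b).2
    have := dist_triangle y (p a) z
    have := dist_triangle (p a) (p b) z
    have := dist_comm y (p a)
    linarith
  have hdist := fun i j => (dist_pt i j).symm
  obtain ⟨k, hk⟩ := limDist_approx (Finset.univ.sup n) (fun j => F (pt (j)))
    (fun i _ j _ => ⟨by rw [hdist]; exact F_lip _ _, by rw [hdist]; exact F_add _ _⟩)
    (ε / 4) (by linarith)
  refine ⟨(pt (k)), fun a => ?_⟩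
  obtain ⟨h1, h2⟩ := hk (n a) (Finset.le_sup (Finset.mem_univ a))
  rw [hdist] at h1 h2
  have h3 := hn a
  have h4 := F_lip (pt (n a)) (p a)
  have h5 := F_lip (p a) (pt (n a))
  rw [F_p] at h4 h5
  have h6 := dist_comm (p a) (pt (n a))
  have h7 := dist_triangle (pt (k)) (pt (n a)) (p a)
  have h8 := dist_triangle (pt (k)) (p a) (pt (n a))
  rw [abs_le]
  constructor <;> linarith

theorem improve {ι : Type} [Fintype ι] (p : ι → UrysohnSpace) (f : ι → ℝ)
    (hf : ∀ a b, |f a - f b| ≤ dist (p a) (p b) ∧ dist (p a) (p b) ≤ f a + f b)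
    (ε : ℝ) (hε : 0 < ε) (x : UrysohnSpace) (hx : ∀ a, |dist x (p a) - f a| ≤ ε) :
    ∃ y : UrysohnSpace, (∀ a, |dist y (p a) - f a| ≤ ε / 2) ∧ dist x y ≤ 2 * ε := by
  rcases isEmpty_or_nonempty ι with h | h
  · exact ⟨x, fun a => h.elim a, by simp; linarith⟩
  set c : ℝ := Finset.univ.sup' Finset.univ_nonempty (fun a => |dist x (p a) - f a|) with hc
  have le_c : ∀ a, |dist x (p a) - f a| ≤ c := fun a =>
    Finset.le_sup' (fun a => |dist x (p a) - f a|) (Finset.mem_univ a)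
  obtain ⟨b₀, -, c_eq⟩ := Finset.exists_mem_eq_sup' (s := Finset.univ) Finset.univ_nonempty
    (fun a => |dist x (p a) - f a|)
  have c_eq : c = |dist x (p b₀) - f b₀| := c_eq
  have c0 : 0 ≤ c := c_eq ▸ abs_nonneg _
  have cε : c ≤ ε := c_eq ▸ hx b₀
  have key : ∀ a, |c - f a| ≤ dist x (p a) ∧ dist x (p a) ≤ c + f a := by
    intro a
    have h1 := abs_le.1 (le_c a)
    have h2 := hf a b₀
    have h3 := abs_le.1 h2.1
    have h4 := dist_triangle x (p a) (p b₀)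
    have h5 := dist_triangle (p a) x (p b₀)
    have h6 := dist_comm x (p a)
    have h7 : c ≤ dist x (p a) + f a := by
      rw [c_eq]
      refine abs_le.2 ⟨?_, ?_⟩ <;> linarith
    refine ⟨abs_le.2 ⟨?_, ?_⟩, ?_⟩ <;> linarith
  obtain ⟨y, hy⟩ := approx (ι := Option ι) (fun o => o.elim x p) (fun o => o.elim c f) (by
    rintro (_ | a) (_ | b)
    · simpa using c0
    · exact key b
    · have := key a
      rw [abs_sub_comm, dist_comm, add_comm] at this
      exact this
    · exact hf a b) (ε / 2) (by linarith)
  refine ⟨y, fun a => hy (some a), ?_⟩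
  have := (abs_le.1 (hy none)).2
  simp only [Option.elim] at this
  rw [dist_comm]
  linarith

theorem extension {ι : Type} [Fintype ι] (p : ι → UrysohnSpace) (f : ι → ℝ)
    (hf : ∀ a b, |f a - f b| ≤ dist (p a) (p b) ∧ dist (p a) (p b) ≤ f a + f b) :
    ∃ x : UrysohnSpace, ∀ a, dist x (p a) = f a := by
  have hs : ∀ k : ℕ, ∀ x : UrysohnSpace, (∀ a, |dist x (p a) - f a| ≤ (1 / 2) ^ k) →
      ∃ y : UrysohnSpace, (∀ a, |dist y (p a) - f a| ≤ (1 / 2) ^ (k + 1)) ∧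
        dist x y ≤ 2 * (1 / 2) ^ k := by
    intro k x hx
    obtain ⟨y, h1, h2⟩ := improve p f hf ((1 / 2) ^ k) (by positivity) x hx
    exact ⟨y, fun a => (h1 a).trans (by rw [pow_succ]; linarith), h2⟩
  obtain ⟨x0, hx0⟩ := approx p f hf 1 one_pos
  have : Nonempty UrysohnSpace := ⟨pt 0⟩
  choose! g hg1 hg2 using hs
  set u : ℕ → UrysohnSpace := fun k => Nat.rec x0 g k with hu
  have hu1 : ∀ k, ∀ a, |dist (u k) (p a) - f a| ≤ (1 / 2) ^ k := by
    intro k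
    induction k with
    | zero => intro a; rw [pow_zero]; exact hx0 a
    | succ k ih => exact hg1 k (u k) ih
  have hc : CauchySeq u := cauchySeq_of_le_geometric (1 / 2) 2 (by norm_num)
    fun k => hg2 k (u k) (hu1 k)
  obtain ⟨x, hx⟩ := cauchySeq_tendsto_of_complete hc
  refine ⟨x, fun a => ?_⟩
  have h1 : Tendsto (fun k => |dist (u k) (p a) - f a|) atTop (𝓝 |dist x (p a) - f a|) :=
    ((hx.dist tendsto_const_nhds).sub tendsto_const_nhds).abs
  have h2 : Tendsto (fun k : ℕ => ((1 : ℝ) / 2) ^ k) atTop (𝓝 0) :=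
    tendsto_pow_atTop_nhds_zero_of_lt_one (by norm_num) (by norm_num)
  have h3 := le_of_tendsto_of_tendsto' h1 h2 fun k => hu1 k a
  exact sub_eq_zero.1 (abs_nonpos_iff.1 h3)

end UrysohnConstruction

theorem isUrysohn_urysohnSpace : IsUrysohn UrysohnSpace where
  complete := inferInstance
  separable := inferInstance
  extension A f hf := by
    obtain ⟨x, hx⟩ := UrysohnConstruction.extension (ι := A) (fun a => a) (fun a => f a)
      fun a b => hf a a.2 b b.2
    exact ⟨x, fun a ha => hx ⟨a, ha⟩⟩

/-! ### Borel reducibility -/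

/-- `R ≤_B S`: there is a Borel map `f` with `R x x' ↔ S (f x) (f x')`. -/
def BorelReducible {X Y : Type*} [MeasurableSpace X] [MeasurableSpace Y]
    (R : X → X → Prop) (S : Y → Y → Prop) : Prop :=
  ∃ f : X → Y, Measurable f ∧ ∀ x x', R x x' ↔ S (f x) (f x')

/-- `R ∼_B S`. -/
def BorelBireducible {X Y : Type*} [MeasurableSpace X] [MeasurableSpace Y]
    (R : X → X → Prop) (S : Y → Y → Prop) : Prop :=
  BorelReducible R S ∧ BorelReducible S R

/-- Isomorphism on the space of graphs with vertex set `ℕ`, whose Borel structure is the one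
induced from `2 ^ (ℕ × ℕ)` by the adjacency relation. -/
def GraphIsomorphism (G H : SimpleGraph ℕ) : Prop := Nonempty (G ≃g H)

/-! ### Spaces of ultrametric Polish spaces -/

/-- The nonempty closed subsets of `X`. -/
structure NonemptyClosed (X : Type*) [TopologicalSpace X] where
  carrier : Set X
  isClosed : IsClosed carrier
  nonempty : carrier.Nonempty

/-- The Effros Borel structure, generated by the sets `{F | F ∩ V ≠ ∅}` with `V` open. -/
instance {X : Type*} [TopologicalSpace X] : MeasurableSpace (NonemptyClosed X) :=
  MeasurableSpace.generateFrom
    {S | ∃ V : Set X, IsOpen V ∧ S = {F : NonemptyClosed X | (F.carrier ∩ V).Nonempty}}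

/-- The set of the distances realised in `X`. -/
def distanceSet (X : Type*) [MetricSpace X] : Set ℝ := {r | ∃ x y : X, dist x y = r}

/-- The ultrametric Polish spaces all of whose distances are in `D`. -/
def USpaces (D : Set ℝ) : Set (NonemptyClosed UrysohnSpace) :=
  {U | IsUltrametricDist U.carrier ∧ distanceSet U.carrier ⊆ D}

/-- The ultrametric Polish spaces whose set of distances is exactly `D`. -/
def USpacesStar (D : Set ℝ) : Set (NonemptyClosed UrysohnSpace) :=
  {U | IsUltrametricDist U.carrier ∧ distanceSet U.carrier = D}

/-- `U` and `V` are isometric. -/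
def IsometricSpaces (U V : NonemptyClosed UrysohnSpace) : Prop :=
  Nonempty (U.carrier ≃ᵢ V.carrier)

/-- There is a distance preserving map from `U` to `V`. -/
def IsometricallyEmbeds (U V : NonemptyClosed UrysohnSpace) : Prop :=
  ∃ f : U.carrier → V.carrier, Isometry f

/-! ### Rooted combinatorial trees and the map `θ` -/

/-- Rooted combinatorial trees with vertex set `ℕ`: a connected acyclic graph and a root. -/
abbrev RootedCombTree : Type := {p : SimpleGraph ℕ × ℕ // p.1.IsTree}

namespace RootedCombTree

def graph (G : RootedCombTree) : SimpleGraph ℕ := G.1.1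

def root (G : RootedCombTree) : ℕ := G.1.2

/-- Isomorphism of rooted combinatorial trees. -/
def Isomorphic (G H : RootedCombTree) : Prop := ∃ f : G.graph ≃g H.graph, f G.root = H.root

/-- Embeddability of rooted combinatorial trees. -/
def Embeds (G H : RootedCombTree) : Prop := ∃ f : G.graph ↪g H.graph, f G.root = H.root

/-- The copy of `G` inside the finite sequences of natural numbers: the vertex `v` becomes the
sequence `(v₁, …, vₙ = v)` such that `(root, v₁, …, vₙ)` is the path from the root to `v`. The root
becomes the empty sequence, and two vertices are adjacent if and only if one of the two sequences
extends the other by one entry. -/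
def sequences (G : RootedCombTree) : Set (List ℕ) :=
  {s | (G.root :: s).IsChain G.graph.Adj ∧ (G.root :: s).Nodup}

end RootedCombTree

/-- The distance on finite sequences determined by `r`: for `s ≠ t` it is `r n` for the greatest `n`
such that the restrictions of `s` and `t` to `n` agree. -/
def sequenceDist (r : ℕ → ℝ) (s t : List ℕ) : ℝ :=
  if s = t then 0
  else r (Nat.findGreatest (fun n => s.take n = t.take n) (max s.length t.length))

/-- `ρ` is an isometric embedding into the Urysohn space of the set of the finite sequences with the
distance `sequenceDist r`. -/
def IsSequenceEmbedding (r : ℕ → ℝ) (ρ : List ℕ → UrysohnSpace) : Prop :=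
  ∀ s t, dist (ρ s) (ρ t) = sequenceDist r s t

end

/-! Isometry reduces to graph isomorphism because an ultrametric space is determined by its balls.
Borel selectors choose a dense sequence in each closed set, and `ballGraph` records which balls of
positive rational radius around these points meet. Each ball is coded by infinitely many vertices,
so the choice of the dense sequence does not matter, and a ray attached to the vertices labels the
radii. An isometry permutes the balls of each radius (`nonempty_ballGraph_iso`). Conversely, a graph
isomorphism fixes the ray and preserves all comparisons of distances with radii, and following the
images of shrinking balls gives an isometry (`nonempty_isometryEquiv_of_ballGraph_iso`).

For the reduction of graph isomorphism, a graph `G` is coded by the set of finite sequences of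
vertices that satisfy an atomic condition selected by their length. In the metric given by a
decreasing sequence of radii, the balls are the cones of sequences with a common restriction. Inside
the cone of `s`, the point `s` forms a piece of one point, while the cone of every `s ++ [k]`
contains at least two points of the code. An isometry between two codes therefore matches cones of
equal level and recognises whether their vertices belong to the codes. A back-and-forth along cones
yields two enumerations of the vertices that satisfy the same atomic conditions, hence an
isomorphism. To realise exactly the distances in `D`, these sequences replace the point `r 0` in the
ultrametric `max` on `D`; `isMarked_iff` recovers them from the metric alone. As the spaces obtained
lie in `USpacesStar D`, one pair of reductions settles both bireducibility claims.

For rooted trees, a positive limit of `r` makes the image of every set of sequences closed. An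
isometric map preserves agreement of restrictions but not lengths: a sequence may be exchanged with
an extension of it. The correction `treeMap` preserves lengths and extension by one entry, is
injective, and is onto if the original map is. It thus induces an embedding or an isomorphism of
rooted trees. -/

/-! ### Isometries determined by dense families -/

theorem nonempty_isometryEquiv_of_dense {ι X Y : Type*} [MetricSpace X] [MetricSpace Y]
    [CompleteSpace X] [CompleteSpace Y] {x : ι → X} {y : ι → Y} (hx : DenseRange x)
    (hy : DenseRange y) (h : ∀ i j, dist (x i) (x j) = dist (y i) (y j)) : Nonempty (X ≃ᵢ Y) := by
  let e : Set.range x → Y := fun p => y p.2.choose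
  have he : Isometry e := Isometry.of_dist_eq fun p q => by
    show dist (y _) (y _) = dist p.1 q.1
    rw [← h, p.2.choose_spec, q.2.choose_spec]
  have hd : DenseRange ((↑) : Set.range x → X) := by
    rw [DenseRange, Subtype.range_coe]; exact hx
  have hi : IsUniformInducing ((↑) : Set.range x → X) := isUniformInducing_val _
  let F : X → Y := (hi.isDenseInducing hd).extend e
  have hF : Continuous F :=
    (uniformContinuous_uniformly_extend hi hd he.uniformContinuous).continuous
  have hFe : ∀ p : Set.range x, F p = e p := fun p =>
    uniformly_extend_of_ind hi hd he.uniformContinuous p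
  have hFx : ∀ i, F (x i) = y i := fun i => by
    have := hFe ⟨x i, i, rfl⟩
    rw [this]
    -- The index chosen for the point `x i` may differ from `i`; two indices of one point have
    -- images at distance zero.
    have h2 := (⟨i, rfl⟩ : x i ∈ Set.range x).choose_spec
    apply dist_eq_zero.1
    rw [← h]
    exact dist_eq_zero.2 h2
  have hFi : Isometry F := by
    refine Isometry.of_dist_eq fun a b => ?_
    refine hx.induction_on₂ (p := fun a b => dist (F a) (F b) = dist a b) ?_ ?_ a b
    · exact isClosed_eq (by fun_prop) (by fun_prop)
    · intro i j; rw [hFx, hFx, h]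
  have hs : Function.Surjective F := by
    rw [← Set.range_eq_univ]
    refine (hFi.isClosedEmbedding.isClosed_range).closure_eq ▸ (hy.mono ?_).closure_eq
    rintro _ ⟨i, rfl⟩
    exact ⟨x i, hFx i⟩
  exact ⟨⟨Equiv.ofBijective F ⟨hFi.injective, hs⟩, hFi⟩⟩

/-! ### Countable metric spaces inside the Urysohn space -/

namespace UrysohnConstruction

/-- The points are placed one at a time: the distances `d n ·` to the earlier points form an
admissible one-point extension by the triangle inequality. Stage `n` changes only the value at `n`,
so the diagonal of the stages is the desired sequence. Distance zero between different indices is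
allowed, which lets a countable space be enumerated with repetitions. -/
theorem exists_seq_dist_eq {d : ℕ → ℕ → ℝ} (hd : IsPM d) :
    ∃ ρ : ℕ → UrysohnSpace, ∀ i j, dist (ρ i) (ρ j) = d i j := by
  have step : ∀ n (u : {u : ℕ → UrysohnSpace // ∀ i < n, ∀ j < n, dist (u i) (u j) = d i j}),
      ∃ v : {u : ℕ → UrysohnSpace // ∀ i < n + 1, ∀ j < n + 1, dist (u i) (u j) = d i j},
        ∀ i < n, v.1 i = u.1 i := by
    rintro n ⟨u, hu⟩
    obtain ⟨x, hx⟩ := extension (fun i : Fin n => u i) (fun i => d n i) (by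
      intro a b
      rw [hu a a.2 b b.2, abs_le]
      have h1 := hd.tri n a b
      have h2 := hd.tri n b a
      have h3 := hd.tri a n b
      rw [hd.symm a n] at h3
      rw [hd.symm b a] at h2
      refine ⟨⟨?_, ?_⟩, ?_⟩ <;> linarith)
    have hx' : ∀ i < n, dist x (u i) = d n i := fun i hi => hx ⟨i, hi⟩
    refine ⟨⟨Function.update u n x, fun i hi j hj => ?_⟩, fun i hi => ?_⟩
    · by_cases h1 : i = n <;> by_cases h2 : j = n
      · subst h1; subst h2; simp [hd.self]
      · subst h1; simp [Function.update_of_ne h2, hx' j (by omega)]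
      · subst h2; simp [Function.update_of_ne h1, dist_comm, hd.symm, hx' i (by omega)]
      · simp [Function.update_of_ne h1, Function.update_of_ne h2,
          hu i (by omega) j (by omega)]
    · simp [Function.update_of_ne (show i ≠ n by omega)]
  choose f hf using step
  let u : ∀ n, {u : ℕ → UrysohnSpace // ∀ i < n, ∀ j < n, dist (u i) (u j) = d i j} := fun n =>
    Nat.rec ⟨fun _ => pt 0, by simp⟩ (fun n u => f n u) n
  have hu : ∀ i n, i < n → (u n).1 i = (u (i + 1)).1 i := by
    intro i n hn
    induction n, hn using Nat.le_induction with
    | base => rfl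
    | succ n hn ih => rw [← ih]; exact hf n (u n) i hn
  refine ⟨fun i => (u (i + 1)).1 i, fun i j => ?_⟩
  change dist ((u (i + 1)).1 i) ((u (j + 1)).1 j) = d i j
  rw [← hu i (i + j + 1) (by omega), ← hu j (i + j + 1) (by omega)]
  exact (u (i + j + 1)).2 i (by omega) j (by omega)

theorem exists_dist_eq {W : Type*} [Countable W] [Nonempty W] (d : W → W → ℝ)
    (hself : ∀ a, d a a = 0) (hsymm : ∀ a b, d a b = d b a)
    (htri : ∀ a b c, d a c ≤ d a b + d b c) :
    ∃ ρ : W → UrysohnSpace, ∀ a b, dist (ρ a) (ρ b) = d a b := by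
  obtain ⟨g, hg⟩ := exists_surjective_nat W
  obtain ⟨ρ, hρ⟩ := exists_seq_dist_eq (d := fun i j => d (g i) (g j))
    ⟨fun _ => hself _, fun _ _ => hsymm _ _, fun _ _ _ => htri _ _ _⟩
  refine ⟨fun w => ρ (Function.surjInv hg w), fun a b => ?_⟩
  rw [hρ, Function.surjInv_eq hg, Function.surjInv_eq hg]

end UrysohnConstruction

/-! ### The tree metric on finite sequences -/

section SequenceDist

variable {r : ℕ → ℝ}

theorem sequenceDist_self (s : List ℕ) : sequenceDist r s s = 0 := by simp [sequenceDist]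

theorem sequenceDist_comm (s t : List ℕ) : sequenceDist r s t = sequenceDist r t s := by
  simp only [sequenceDist, eq_comm, max_comm]

theorem List.take_eq_take_of_le {α : Type*} {s t : List α} {m n : ℕ} (hmn : m ≤ n)
    (h : s.take n = t.take n) : s.take m = t.take m := by
  have := congrArg (List.take m) h
  simpa [List.take_take, hmn] using this

/-- The lengths at which the restrictions agree form an initial segment. The search bound in
`sequenceDist` loses nothing, since truncation at the larger of the two lengths changes neither
sequence. -/
theorem exists_sequenceDist_eq {s t : List ℕ} (h : s ≠ t) : ∃ n, sequenceDist r s t = r n ∧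
    ∀ m, s.take m = t.take m ↔ m ≤ n := by
  refine ⟨_, by rw [sequenceDist, if_neg h], fun m => ⟨fun hm => ?_, fun hm => ?_⟩⟩
  · refine Nat.le_findGreatest ?_ hm
    by_contra! hlt
    rw [List.take_of_length_le (by omega), List.take_of_length_le (by omega)] at hm
    exact h hm
  · refine List.take_eq_take_of_le hm ?_
    exact Nat.findGreatest_spec (P := fun n => s.take n = t.take n) (Nat.zero_le _) (by simp)

/-- This is the dictionary between metric and tree: the closed balls of radius `r n` are the classes
of equal restriction to `n`. A sequence shorter than `n` is alone in its class. -/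
theorem sequenceDist_le_iff (hr : StrictAnti r) (h0 : ∀ n, 0 < r n) {s t : List ℕ} {n : ℕ} :
    sequenceDist r s t ≤ r n ↔ s.take n = t.take n := by
  by_cases h : s = t
  · subst h; simp [sequenceDist_self, (h0 n).le]
  · obtain ⟨m, hm, hm'⟩ := exists_sequenceDist_eq (r := r) h
    rw [hm, hr.le_iff_ge, hm']

theorem sequenceDist_nonneg (h0 : ∀ n, 0 < r n) (s t : List ℕ) : 0 ≤ sequenceDist r s t := by
  rw [sequenceDist]; split_ifs
  · exact le_rfl
  · exact (h0 _).le

theorem sequenceDist_eq_zero (h0 : ∀ n, 0 < r n) {s t : List ℕ} :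
    sequenceDist r s t = 0 ↔ s = t := by
  rw [sequenceDist]; split_ifs with h
  · simp [h]
  · simp [h, (h0 _).ne']

theorem sequenceDist_le_max (hr : StrictAnti r) (h0 : ∀ n, 0 < r n) (s t u : List ℕ) :
    sequenceDist r s u ≤ max (sequenceDist r s t) (sequenceDist r t u) := by
  by_cases h1 : s = t
  · subst h1; exact le_max_right _ _
  by_cases h2 : t = u
  · subst h2; exact le_max_left _ _
  obtain ⟨m, hm, hm'⟩ := exists_sequenceDist_eq (r := r) h1
  obtain ⟨n, hn, hn'⟩ := exists_sequenceDist_eq (r := r) h2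
  rw [hm, hn]
  rcases le_total m n with h | h
  · exact le_max_of_le_left ((sequenceDist_le_iff hr h0).2
      (((hm' m).2 le_rfl).trans ((hn' m).2 h)))
  · exact le_max_of_le_right ((sequenceDist_le_iff hr h0).2
      (((hm' n).2 h).trans ((hn' n).2 le_rfl)))

theorem sequenceDist_eq_iff (hr : StrictAnti r) (h0 : ∀ n, 0 < r n) {s t : List ℕ} {n : ℕ} :
    sequenceDist r s t = r n ↔ s.take n = t.take n ∧ s.take (n + 1) ≠ t.take (n + 1) := by
  rw [← sequenceDist_le_iff hr h0, Ne, ← sequenceDist_le_iff hr h0, not_le]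
  refine ⟨fun h => h ▸ ⟨le_rfl, h ▸ hr (Nat.lt_succ_self n)⟩, fun ⟨h1, h2⟩ => ?_⟩
  have hst : s ≠ t := by
    rintro rfl
    rw [sequenceDist_self] at h2
    exact (h2.trans (h0 _)).false
  obtain ⟨m, hm, -⟩ := exists_sequenceDist_eq (r := r) hst
  rw [hm, hr.le_iff_ge] at h1
  rw [hm, hr.lt_iff_gt] at h2
  rw [hm, show m = n by omega]

theorem sequenceDist_map {f : ℕ → ℕ} (hf : Function.Injective f) (s t : List ℕ) :
    sequenceDist r (s.map f) (t.map f) = sequenceDist r s t := by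
  simp only [sequenceDist, ← List.map_take, (List.map_injective_iff.2 hf).eq_iff, List.length_map]

theorem sequenceDist_mem {D : Set ℝ} (h0 : (0 : ℝ) ∈ D) (h : ∀ n, r n ∈ D) (s t : List ℕ) :
    sequenceDist r s t ∈ D := by
  rw [sequenceDist]; split_ifs
  · exact h0
  · exact h _

end SequenceDist

/-! ### Closures of countable sets of points -/

/-- The closure of a nonempty set. -/
def NonemptyClosed.closure {X : Type*} [TopologicalSpace X] (A : Set X) (h : A.Nonempty) :
    NonemptyClosed X :=
  ⟨_root_.closure A, isClosed_closure, h.closure⟩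

/-- An open set meets the closure of a set only if it meets the set itself, so the preimage of a
generator of the Effros structure is a countable union of the sets in `hS`. -/
theorem NonemptyClosed.measurable_closure_image {α W X : Type*} [MeasurableSpace α] [Countable W]
    [TopologicalSpace X] (ρ : W → X) {S : α → Set W} (hne : ∀ a, (S a).Nonempty)
    (hS : ∀ w, MeasurableSet {a | w ∈ S a}) :
    Measurable fun a => NonemptyClosed.closure (ρ '' S a) ((hne a).image ρ) := by
  refine measurable_generateFrom ?_
  rintro _ ⟨V, hV, rfl⟩
  have : (fun a => NonemptyClosed.closure (ρ '' S a) ((hne a).image ρ)) ⁻¹'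
      {F | (F.carrier ∩ V).Nonempty} = ⋃ w ∈ {w | ρ w ∈ V}, {a | w ∈ S a} := by
    ext a
    simp only [Set.mem_preimage, Set.mem_ofPred_eq, NonemptyClosed.closure, Set.mem_iUnion,
      exists_prop]
    rw [closure_inter_open_nonempty_iff hV]
    constructor
    · rintro ⟨_, ⟨w, hw, rfl⟩, hV⟩
      exact ⟨w, hV, hw⟩
    · rintro ⟨w, hV, hw⟩
      exact ⟨_, ⟨w, hw, rfl⟩, hV⟩
  rw [this]
  exact MeasurableSet.biUnion (Set.to_countable _) fun w _ => hS w

theorem isometricSpaces_closure {ι : Type*} {A B : Set UrysohnSpace} (hA : A.Nonempty)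
    (hB : B.Nonempty) (x y : ι → UrysohnSpace) (hx : Set.range x = A) (hy : Set.range y = B)
    (h : ∀ i j, dist (x i) (x j) = dist (y i) (y j)) :
    IsometricSpaces (NonemptyClosed.closure A hA) (NonemptyClosed.closure B hB) := by
  subst hx hy
  have hd : ∀ {x : ι → UrysohnSpace},
      DenseRange fun i => (⟨x i, subset_closure ⟨i, rfl⟩⟩ : closure (Set.range x)) := by
    intro x
    rw [DenseRange, Subtype.dense_iff, ← Set.range_comp]
    exact le_rfl
  have hc : ∀ {x : ι → UrysohnSpace}, CompleteSpace (closure (Set.range x)) :=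
    isClosed_closure.completeSpace_coe
  have := hc (x := x)
  have := hc (x := y)
  exact nonempty_isometryEquiv_of_dense (X := closure (Set.range x)) (Y := closure (Set.range y))
    hd hd h

theorem dist_le_max_of_mem_closure {X : Type*} [MetricSpace X] {A : Set X}
    (h : ∀ x ∈ A, ∀ y ∈ A, ∀ z ∈ A, dist x z ≤ max (dist x y) (dist y z)) {x y z : X}
    (hx : x ∈ closure A) (hy : y ∈ closure A) (hz : z ∈ closure A) :
    dist x z ≤ max (dist x y) (dist y z) := by
  have hc : IsClosed {p : X × X × X | dist p.1 p.2.2 ≤ max (dist p.1 p.2.1) (dist p.2.1 p.2.2)} :=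
    isClosed_le (by fun_prop) (by fun_prop)
  have : closure (A ×ˢ A ×ˢ A) ⊆ _ := closure_minimal
    (fun p hp => h p.1 hp.1 p.2.1 hp.2.1 p.2.2 hp.2.2) hc
  rw [closure_prod_eq, closure_prod_eq] at this
  exact this (show (x, y, z) ∈ _ from ⟨hx, hy, hz⟩)

theorem dist_eq_of_dist_lt {X : Type*} [MetricSpace X] {A : Set X}
    (h : ∀ x ∈ A, ∀ y ∈ A, ∀ z ∈ A, dist x z ≤ max (dist x y) (dist y z)) {x x' y : X}
    (hx : x ∈ A) (hx' : x' ∈ A) (hy : y ∈ A) (hd : dist x x' < dist x y) :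
    dist x' y = dist x y := by
  have h1 := h x' hx' x hx y hy
  have h2 := h x hx x' hx' y hy
  rw [dist_comm x' x, max_eq_right hd.le] at h1
  exact le_antisymm h1 ((le_max_iff.1 h2).resolve_left (not_le.2 hd))

/-- In an ultrametric space, moving an endpoint by less than the distance leaves the distance
unchanged. Closures therefore create no new distances. -/
theorem exists_dist_eq_of_mem_closure {X : Type*} [MetricSpace X] {A : Set X}
    (h : ∀ x ∈ A, ∀ y ∈ A, ∀ z ∈ A, dist x z ≤ max (dist x y) (dist y z)) {x y : X}
    (hx : x ∈ closure A) (hy : y ∈ closure A) (hxy : x ≠ y) :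
    ∃ x' ∈ A, ∃ y' ∈ A, dist x' y' = dist x y ∧ dist x x' < dist x y ∧ dist y y' < dist x y := by
  have hc := fun x y z hx hy hz => dist_le_max_of_mem_closure (x := x) (y := y) (z := z) h hx hy hz
  have hc' : ∀ x ∈ closure A, ∀ y ∈ closure A, ∀ z ∈ closure A,
    dist x z ≤ max (dist x y) (dist y z) := fun x hx y hy z hz => hc x y z hx hy hz
  obtain ⟨x', hx', h1⟩ := Metric.mem_closure_iff.1 hx _ (dist_pos.2 hxy)
  obtain ⟨y', hy', h2⟩ := Metric.mem_closure_iff.1 hy _ (dist_pos.2 hxy)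
  refine ⟨x', hx', y', hy', ?_, h1, h2⟩
  have e1 := dist_eq_of_dist_lt hc' hx (subset_closure hx') hy h1
  have e2 := dist_eq_of_dist_lt hc' hy (subset_closure hy') (subset_closure hx')
    (by rw [dist_comm y x', e1]; exact h2)
  rw [dist_comm, e2, dist_comm, e1]

theorem isUltrametricDist_closure {A : Set UrysohnSpace} (hA : A.Nonempty)
    (h : ∀ x ∈ A, ∀ y ∈ A, ∀ z ∈ A, dist x z ≤ max (dist x y) (dist y z)) :
    IsUltrametricDist (NonemptyClosed.closure A hA).carrier :=
  ⟨fun x y z => dist_le_max_of_mem_closure h x.2 y.2 z.2⟩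

theorem distanceSet_closure {A : Set UrysohnSpace} (hA : A.Nonempty)
    (h : ∀ x ∈ A, ∀ y ∈ A, ∀ z ∈ A, dist x z ≤ max (dist x y) (dist y z)) :
    distanceSet (NonemptyClosed.closure A hA).carrier = {d | ∃ x ∈ A, ∃ y ∈ A, dist x y = d} := by
  ext d
  constructor
  · rintro ⟨x, y, rfl⟩
    by_cases hxy : x = y
    · subst hxy
      obtain ⟨a, ha⟩ := hA
      exact ⟨a, ha, a, ha, by simp⟩
    · obtain ⟨x', hx', y', hy', e, -⟩ := exists_dist_eq_of_mem_closure h x.2 y.2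
        (fun e => hxy (Subtype.ext e))
      exact ⟨x', hx', y', hy', e⟩
  · rintro ⟨x, hx, y, hy, rfl⟩
    exact ⟨⟨x, subset_closure hx⟩, ⟨y, subset_closure hy⟩, rfl⟩

/-! ### Coding graphs by sets of sequences -/

/-- The sequences of natural numbers `s` such that the fact about `G` and the entries of `s` which
is selected by the length of `s` holds. -/
def graphSequences (G : SimpleGraph ℕ) : Set (List ℕ) :=
  {s | (s.length.unpair.1 % 3 = 0 → ∃ a b, s[s.length.unpair.2.unpair.1]? = some a ∧
      s[s.length.unpair.2.unpair.2]? = some b ∧ G.Adj a b) ∧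
    (s.length.unpair.1 % 3 = 1 →
      s[s.length.unpair.2.unpair.1]? = s[s.length.unpair.2.unpair.2]?)}

/-- Lengths with code of residue 2 impose no condition, so padding with zeros up to such a length
suffices. Two extensions are needed: they distinguish a cone from a single point. -/
theorem exists_prefix_mem_graphSequences (G : SimpleGraph ℕ) (s : List ℕ) :
    ∃ x ∈ graphSequences G, ∃ y ∈ graphSequences G, s <+: x ∧ s <+: y ∧ s.length < x.length ∧
      s.length < y.length ∧ x ≠ y := by
  have key : ∀ m, s.length < m → ∃ x ∈ graphSequences G, s <+: x ∧
      x.length = Nat.pair (3 * m + 2) 0 := by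
    intro m hm
    have h1 : 3 * m + 2 ≤ Nat.pair (3 * m + 2) 0 := Nat.left_le_pair _ _
    have hl : (s ++ List.replicate (Nat.pair (3 * m + 2) 0 - s.length) 0).length =
        Nat.pair (3 * m + 2) 0 := by
      simp only [List.length_append, List.length_replicate]; omega
    refine ⟨s ++ List.replicate (Nat.pair (3 * m + 2) 0 - s.length) 0, ?_, by simp, hl⟩
    simp only [graphSequences, Set.mem_ofPred_eq, hl, Nat.unpair_pair]
    refine ⟨fun h => by omega, fun h => by omega⟩
  obtain ⟨x, hx, h1, h2⟩ := key (s.length + 1) (by omega)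
  obtain ⟨y, hy, h3, h4⟩ := key (s.length + 2) (by omega)
  have h5 := Nat.left_le_pair (3 * (s.length + 1) + 2) 0
  have h6 := Nat.left_le_pair (3 * (s.length + 2) + 2) 0
  refine ⟨x, hx, y, hy, h1, h3, by omega, by omega, ?_⟩
  rintro rfl
  rw [h2, Nat.pair_eq_pair] at h4
  omega

theorem map_mem_graphSequences {G H : SimpleGraph ℕ} (e : G ≃g H) {s : List ℕ}
    (hs : s ∈ graphSequences G) : s.map e ∈ graphSequences H := by
  refine ⟨fun h => ?_, fun h => ?_⟩
  · rw [List.length_map] at h ⊢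
    obtain ⟨a, b, ha, hb, hab⟩ := hs.1 h
    exact ⟨e a, e b, by simp [ha], by simp [hb], e.map_rel_iff.2 hab⟩
  · rw [List.length_map] at h ⊢
    rw [List.getElem?_map, List.getElem?_map, hs.2 h]

/-- Lengths of residue 1 decode equality of entries, which makes `x i ↦ y i` a well defined
bijection; lengths of residue 0 decode adjacency. -/
theorem graphIsomorphism_of_seq {G H : SimpleGraph ℕ} {x y : ℕ → ℕ} (hx : Function.Surjective x)
    (hy : Function.Surjective y) (h : ∀ n, (List.range n).map x ∈ graphSequences G ↔
      (List.range n).map y ∈ graphSequences H) : GraphIsomorphism G H := by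
  have get : ∀ (z : ℕ → ℕ) n i, i < n → ((List.range n).map z)[i]? = some (z i) := by
    intro z n i hi
    rw [List.getElem?_map, List.getElem?_range hi, Option.map_some]
  have adj : ∀ i j, G.Adj (x i) (x j) ↔ H.Adj (y i) (y j) := by
    intro i j
    -- The summand `i + j + 1` makes the length exceed `i` and `j`, so that both entries exist.
    have h1 := Nat.left_le_pair (3 * (i + j + 1)) (Nat.pair i j)
    have := h (Nat.pair (3 * (i + j + 1)) (Nat.pair i j))
    simp only [graphSequences, Set.mem_ofPred_eq, List.length_map, List.length_range,
      Nat.unpair_pair, get _ _ i (show i < Nat.pair (3 * (i + j + 1)) (Nat.pair i j) by omega),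
      get _ _ j (show j < Nat.pair (3 * (i + j + 1)) (Nat.pair i j) by omega)] at this
    simpa using this
  have eq : ∀ i j, x i = x j ↔ y i = y j := by
    intro i j
    have h1 := Nat.left_le_pair (3 * (i + j + 1) + 1) (Nat.pair i j)
    have := h (Nat.pair (3 * (i + j + 1) + 1) (Nat.pair i j))
    simp only [graphSequences, Set.mem_ofPred_eq, List.length_map, List.length_range,
      Nat.unpair_pair, get _ _ i (show i < Nat.pair (3 * (i + j + 1) + 1) (Nat.pair i j) by omega),
      get _ _ j (show j < Nat.pair (3 * (i + j + 1) + 1) (Nat.pair i j) by omega)] at this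
    simpa [Nat.add_mod] using this
  have h1 : ∀ i, x (Function.surjInv hx (x i)) = x i := fun i => Function.surjInv_eq hx _
  have h2 : ∀ i, y (Function.surjInv hy (y i)) = y i := fun i => Function.surjInv_eq hy _
  refine ⟨⟨⟨fun v => y (Function.surjInv hx v), fun v => x (Function.surjInv hy v), fun v => ?_,
    fun v => ?_⟩, ?_⟩⟩
  · obtain ⟨i, rfl⟩ := hx v
    rw [eq, h2, ← eq, h1]
  · obtain ⟨i, rfl⟩ := hy v
    rw [← eq, h1, eq, h2]
  · intro a b
    obtain ⟨i, rfl⟩ := hx a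
    obtain ⟨j, rfl⟩ := hx b
    change H.Adj (y _) (y _) ↔ _
    rw [← adj, h1, h1]

/-- `E` is the graph of an isometry between `S` and `T`. -/
structure IsIsometricCorrespondence (r : ℕ → ℝ) (S T : Set (List ℕ))
    (E : List ℕ → List ℕ → Prop) : Prop where
  left : ∀ s ∈ S, ∃ t, E s t
  right : ∀ t ∈ T, ∃ s, E s t
  mem : ∀ s t, E s t → s ∈ S ∧ t ∈ T
  dist : ∀ s t s' t', E s t → E s' t' → sequenceDist r s s' = sequenceDist r t t'

namespace IsIsometricCorrespondence

variable {r : ℕ → ℝ} {S T : Set (List ℕ)} {E : List ℕ → List ℕ → Prop}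

theorem symm (h : IsIsometricCorrespondence r S T E) :
    IsIsometricCorrespondence r T S fun t s => E s t :=
  ⟨h.right, h.left, fun s t e => (h.mem t s e).symm,
    fun s t s' t' e e' => (h.dist t s t' s' e e').symm⟩

/-- The isometry maps the ball of the extensions of `s` onto the ball of the extensions of `t`. -/
def MapsBall (E : List ℕ → List ℕ → Prop) (s t : List ℕ) : Prop :=
  s.length = t.length ∧ ∀ x y, E x y → (s <+: x ↔ t <+: y)

theorem MapsBall.symm {s t : List ℕ} (h : MapsBall E s t) : MapsBall (fun t s => E s t) t s :=
  ⟨h.1.symm, fun x y e => (h.2 y x e).symm⟩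

theorem take_eq_iff (h : IsIsometricCorrespondence r S T E) (hr : StrictAnti r) (h0 : ∀ n, 0 < r n)
    {x y x' y' : List ℕ} (e : E x y) (e' : E x' y') (n : ℕ) :
    x.take n = x'.take n ↔ y.take n = y'.take n := by
  rw [← sequenceDist_le_iff hr h0, h.dist x y x' y' e e', sequenceDist_le_iff hr h0]

theorem eq_iff (h : IsIsometricCorrespondence r S T E) (h0 : ∀ n, 0 < r n)
    {x y x' y' : List ℕ} (e : E x y) (e' : E x' y') : x = x' ↔ y = y' := by
  rw [← sequenceDist_eq_zero h0, h.dist x y x' y' e e', sequenceDist_eq_zero h0]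

/-- Two distinct points in the cone of `s ++ [k]` have distinct images that agree on `t.length + 1`.
The images are therefore longer than `t`, and their common entry at position `t.length` names the
image cone. -/
theorem exists_mapsBall (h : IsIsometricCorrespondence r S T E) (hr : StrictAnti r)
    (h0 : ∀ n, 0 < r n)
    (hS : ∀ s, ∃ x ∈ S, ∃ y ∈ S, s <+: x ∧ s <+: y ∧ s.length < x.length ∧
      s.length < y.length ∧ x ≠ y)
    {s t : List ℕ} (hst : MapsBall E s t) (k : ℕ) : ∃ k', MapsBall E (s ++ [k]) (t ++ [k']) := by
  obtain ⟨x, hx, x', hx', hkx, hkx', -, -, hne⟩ := hS (s ++ [k])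
  obtain ⟨y, e⟩ := h.left x hx
  obtain ⟨y', e'⟩ := h.left x' hx'
  have hty : t <+: y := (hst.2 x y e).1 ((List.prefix_append _ _).trans hkx)
  have hl : (s ++ [k]).length = t.length + 1 := by simp [hst.1]
  have hxt : x.take (t.length + 1) = s ++ [k] := by
    rw [← hl]; exact (List.prefix_iff_eq_take.1 hkx).symm
  have hxt' : x'.take (t.length + 1) = s ++ [k] := by
    rw [← hl]; exact (List.prefix_iff_eq_take.1 hkx').symm
  have hyy : y.take (t.length + 1) = y'.take (t.length + 1) :=
    (h.take_eq_iff hr h0 e e' _).1 (hxt.trans hxt'.symm)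
  have hne' : y ≠ y' := fun he => hne ((h.eq_iff h0 e e').2 he)
  have hly : t.length < y.length := by
    by_contra! hle
    rw [List.take_of_length_le (by omega)] at hyy
    have : y'.length ≤ t.length := by
      have := congrArg List.length hyy
      rw [List.length_take] at this
      omega
    rw [List.take_of_length_le (by omega)] at hyy
    exact hne' hyy
  have hyt : y.take (t.length + 1) = t ++ [y[t.length]] := by
    rw [List.take_succ_eq_append_getElem hly, ← List.prefix_iff_eq_take.1 hty]
  refine ⟨y[t.length], by simp [hst.1], fun z w e₁ => ?_⟩
  rw [List.prefix_iff_eq_take, List.prefix_iff_eq_take, hl, ← hxt, ← hyt, hxt, ← hxt,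
    h.take_eq_iff hr h0 e e₁, List.length_take, min_eq_left (by omega)]

/-- If the partner `y` of `s` were a proper extension of `t`, the cone of its restriction to
`t.length + 1` would contain two points of `T`. Their partners agree with `s` on one level more than
the length of `s`, hence equal `s`, a contradiction. -/
theorem mem_of_mapsBall (h : IsIsometricCorrespondence r S T E) (hr : StrictAnti r)
    (h0 : ∀ n, 0 < r n)
    (hT : ∀ s, ∃ x ∈ T, ∃ y ∈ T, s <+: x ∧ s <+: y ∧ s.length < x.length ∧
      s.length < y.length ∧ x ≠ y)
    {s t : List ℕ} (hst : MapsBall E s t) (hs : s ∈ S) : t ∈ T := by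
  obtain ⟨y, e⟩ := h.left s hs
  have hty : t <+: y := (hst.2 s y e).1 List.prefix_rfl
  by_cases hl : y.length ≤ t.length
  · rw [hty.eq_of_length_le hl]
    exact (h.mem _ _ e).2
  · obtain ⟨u, hu, u', hu', hyu, hyu', -, -, hne⟩ := hT (y.take (t.length + 1))
    have key : ∀ u ∈ T, y.take (t.length + 1) <+: u → u = y := by
      intro u hu hyu
      obtain ⟨z, e'⟩ := h.right u hu
      rw [List.prefix_iff_eq_take, List.length_take, min_eq_left (by omega),
        ← h.take_eq_iff hr h0 e e', ← hst.1, List.take_of_length_le (by omega)] at hyu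
      have hz : z.length ≤ s.length := by
        have := congrArg List.length hyu
        rw [List.length_take] at this
        omega
      rw [List.take_of_length_le (by omega)] at hyu
      exact ((h.eq_iff h0 e e').1 hyu).symm
    exact absurd ((key u hu hyu).trans (key u' hu' hyu').symm) hne

/-- Back-and-forth: step `2 * k` puts `k` into the first enumeration, step `2 * k + 1` puts `k` into
the second. -/
theorem exists_seq {P : List ℕ → List ℕ → Prop} (hnil : P [] [])
    (hl : ∀ s t k, P s t → ∃ k', P (s ++ [k]) (t ++ [k']))
    (hr : ∀ s t k', P s t → ∃ k, P (s ++ [k]) (t ++ [k'])) :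
    ∃ x y : ℕ → ℕ, Function.Surjective x ∧ Function.Surjective y ∧
      ∀ n, P ((List.range n).map x) ((List.range n).map y) := by
  have step : ∀ n s t, ∃ k k' : ℕ, P s t → P (s ++ [k]) (t ++ [k']) ∧
      (n % 2 = 0 → k = n / 2) ∧ (n % 2 = 1 → k' = n / 2) := by
    intro n s t
    by_cases h : P s t
    · rcases Nat.mod_two_eq_zero_or_one n with hn | hn
      · obtain ⟨k', hk'⟩ := hl s t (n / 2) h
        exact ⟨n / 2, k', fun _ => ⟨hk', fun _ => rfl, fun _ => by omega⟩⟩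
      · obtain ⟨k, hk⟩ := hr s t (n / 2) h
        exact ⟨k, n / 2, fun _ => ⟨hk, fun _ => by omega, fun _ => rfl⟩⟩
    · exact ⟨0, 0, fun h' => absurd h' h⟩
  choose f g hfg using step
  let u : ℕ → List ℕ × List ℕ := fun n =>
    Nat.rec ([], []) (fun n p => (p.1 ++ [f n p.1 p.2], p.2 ++ [g n p.1 p.2])) n
  let x : ℕ → ℕ := fun n => f n (u n).1 (u n).2
  let y : ℕ → ℕ := fun n => g n (u n).1 (u n).2
  have hu : ∀ n, u n = ((List.range n).map x, (List.range n).map y) := by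
    intro n
    induction n with
    | zero => rfl
    | succ n ih =>
      rw [List.range_succ, List.map_append, List.map_append]
      change ((u n).1 ++ [x n], (u n).2 ++ [y n]) = _
      rw [ih]; rfl
  have hP : ∀ n, P (u n).1 (u n).2 := by
    intro n
    induction n with
    | zero => exact hnil
    | succ n ih => exact (hfg n _ _ ih).1
  refine ⟨x, y, fun k => ⟨2 * k, ?_⟩, fun k => ⟨2 * k + 1, ?_⟩, fun n => ?_⟩
  · exact ((hfg (2 * k) _ _ (hP (2 * k))).2.1 (by omega)).trans (by omega)
  · exact ((hfg (2 * k + 1) _ _ (hP (2 * k + 1))).2.2 (by omega)).trans (by omega)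
  · have := hP n
    rwa [hu] at this

theorem graphIsomorphism {G H : SimpleGraph ℕ} (hr : StrictAnti r) (h0 : ∀ n, 0 < r n)
    (h : IsIsometricCorrespondence r (graphSequences G) (graphSequences H) E) :
    GraphIsomorphism G H := by
  have hG := exists_prefix_mem_graphSequences G
  have hH := exists_prefix_mem_graphSequences H
  obtain ⟨x, y, hx, hy, hxy⟩ := exists_seq (P := MapsBall E) ⟨rfl, by simp⟩
    (fun s t k hst => h.exists_mapsBall hr h0 hG hst k)
    (fun s t k hst => by
      obtain ⟨k', hk'⟩ := h.symm.exists_mapsBall hr h0 hH hst.symm k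
      exact ⟨k', hk'.symm⟩)
  exact graphIsomorphism_of_seq hx hy fun n =>
    ⟨h.mem_of_mapsBall hr h0 hH (hxy n), h.symm.mem_of_mapsBall hr h0 hG (hxy n).symm⟩

end IsIsometricCorrespondence

/-! ### From graphs to ultrametric spaces -/

/-- A copy of the finite sequences, and a point for every distance in `D` except `c`. -/
abbrev CodeSpace (D : Set ℝ) (c : ℝ) : Type := List ℕ ⊕ {y : ℝ // y ∈ D ∧ y ≠ c}

open Classical in
/-- The ultrametric obtained from `max` on `D` by replacing the point `r 0` by the sequences. -/
noncomputable def codeDist (D : Set ℝ) (r : ℕ → ℝ) : CodeSpace D (r 0) → CodeSpace D (r 0) → ℝ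
  | .inl s, .inl t => sequenceDist (fun n => r (n + 1)) s t
  | .inl _, .inr y => max (r 0) y
  | .inr y, .inl _ => max (r 0) y
  | .inr y, .inr z => if y = z then 0 else max y.1 z.1

/-- The subspace coding the graph `G`. -/
def codeSet (D : Set ℝ) (c : ℝ) (G : SimpleGraph ℕ) : Set (CodeSpace D c) :=
  {w | Sum.elim (· ∈ graphSequences G) (fun _ => True) w}

theorem codeSet_nonempty (D : Set ℝ) (c : ℝ) (G : SimpleGraph ℕ) : (codeSet D c G).Nonempty := by
  obtain ⟨x, hx, -⟩ := exists_prefix_mem_graphSequences G []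
  exact ⟨.inl x, hx⟩

/-- `x` is isolated and a vertex of an equilateral triangle of side `c`. -/
def IsMarked {X : Type*} [MetricSpace X] (c : ℝ) (x : X) : Prop :=
  (∃ ε > 0, ∀ y, dist x y < ε → y = x) ∧ ∃ p q, dist x p = c ∧ dist x q = c ∧ dist p q = c

theorem IsMarked.map {X Y : Type*} [MetricSpace X] [MetricSpace Y] (f : X ≃ᵢ Y) {c : ℝ} {x : X}
    (h : IsMarked c x) : IsMarked c (f x) := by
  obtain ⟨⟨ε, hε, h1⟩, p, q, h2⟩ := h
  refine ⟨⟨ε, hε, fun y hy => ?_⟩, f p, f q, by simpa only [f.dist_eq] using h2⟩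
  obtain ⟨y, rfl⟩ := f.surjective y
  rw [f.dist_eq] at hy
  rw [h1 y hy]

section

variable {D : Set ℝ} {r : ℕ → ℝ}

theorem StrictAnti.pos_of_forall_mem (hr : StrictAnti r) (hD : ∀ x ∈ D, 0 ≤ x)
    (h : ∀ n, r n ∈ D) (n : ℕ) : 0 < r n :=
  (hD _ (h (n + 1))).trans_lt (hr (Nat.lt_succ_self n))

theorem codeDist_self (w : CodeSpace D (r 0)) : codeDist D r w w = 0 := by
  rcases w with s | y <;> simp [codeDist, sequenceDist_self]

theorem codeDist_comm (v w : CodeSpace D (r 0)) : codeDist D r v w = codeDist D r w v := by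
  rcases v with s | y <;> rcases w with t | z <;>
    simp [codeDist, sequenceDist_comm, max_comm, eq_comm]

theorem codeDist_nonneg (hD : ∀ x ∈ D, 0 ≤ x) (h0 : ∀ n, 0 < r n) (v w : CodeSpace D (r 0)) :
    0 ≤ codeDist D r v w := by
  rcases v with s | y <;> rcases w with t | z <;> simp only [codeDist]
  · exact sequenceDist_nonneg (fun n => h0 _) _ _
  · exact le_max_of_le_left (h0 0).le
  · exact le_max_of_le_left (h0 0).le
  · split_ifs
    · exact le_rfl
    · exact le_max_of_le_left (hD _ y.2.1)

theorem codeDist_inl_lt (hr : StrictAnti r) (h0 : ∀ n, 0 < r n) (s t : List ℕ) :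
    codeDist D r (.inl s) (.inl t) < r 0 := by
  simp only [codeDist, sequenceDist]
  split_ifs
  · exact h0 0
  · exact hr (Nat.succ_pos _)

theorem codeDist_le_max (hr : StrictAnti r) (hD : ∀ x ∈ D, 0 ≤ x) (h0 : ∀ n, 0 < r n)
    (u v w : CodeSpace D (r 0)) :
    codeDist D r u w ≤ max (codeDist D r u v) (codeDist D r v w) := by
  rcases u with s | x <;> rcases v with t | y <;> rcases w with u | z
  · exact sequenceDist_le_max (fun _ _ h => hr (Nat.succ_lt_succ h)) (fun n => h0 _) _ _ _
  · exact le_max_right _ _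
  · exact (codeDist_inl_lt hr h0 _ _).le.trans (le_max_of_le_left (le_max_left _ _))
  · simp only [codeDist]
    split_ifs with h
    · subst h; exact le_max_left _ _
    · exact max_le (le_max_of_le_left (le_max_left _ _))
        (le_max_of_le_right (le_max_right _ _))
  · exact le_max_left _ _
  · simp only [codeDist]
    split_ifs with h
    · exact le_max_of_le_left (le_max_of_le_left (h0 0).le)
    · exact max_le (le_max_of_le_left (le_max_right _ _)) (le_max_of_le_right (le_max_right _ _))
  · simp only [codeDist]
    split_ifs with h
    · subst h; exact le_max_right _ _
    · exact max_le (le_max_of_le_right (le_max_left _ _)) (le_max_of_le_left (le_max_left _ _))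
  · by_cases h1 : x = y
    · subst h1; exact le_max_right _ _
    by_cases h2 : y = z
    · subst h2; exact le_max_left _ _
    by_cases h3 : x = z
    · subst h3
      rw [codeDist_self]
      exact le_max_of_le_left (codeDist_nonneg hD h0 _ _)
    simp only [codeDist, if_neg h1, if_neg h2, if_neg h3]
    exact max_le (le_max_of_le_left (le_max_left _ _)) (le_max_of_le_right (le_max_right _ _))

theorem codeDist_mem (h0 : (0 : ℝ) ∈ D) (hr : ∀ n, r n ∈ D) (v w : CodeSpace D (r 0)) :
    codeDist D r v w ∈ D := by
  rcases v with s | y <;> rcases w with t | z <;> simp only [codeDist]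
  · exact sequenceDist_mem h0 (fun n => hr _) s t
  · rcases max_choice (r 0) z with h | h <;> rw [h]
    exacts [hr 0, z.2.1]
  · rcases max_choice (r 0) y with h | h <;> rw [h]
    exacts [hr 0, y.2.1]
  · split_ifs
    · exact h0
    · rcases max_choice y.1 z.1 with h | h <;> rw [h]
      exacts [y.2.1, z.2.1]

/-- The points `0` and `d` of `D` are at distance `d`. The value `r 0` has no point of its own, but
every sequence is at distance `r 0` from the point `0`. -/
theorem exists_codeDist_eq (hD : ∀ x ∈ D, 0 ≤ x) (h0 : (0 : ℝ) ∈ D) (hr0 : ∀ n, 0 < r n)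
    (G : SimpleGraph ℕ) {d : ℝ} (hd : d ∈ D) :
    ∃ v ∈ codeSet D (r 0) G, ∃ w ∈ codeSet D (r 0) G, codeDist D r v w = d := by
  have hz : (0 : ℝ) ∈ D ∧ (0 : ℝ) ≠ r 0 := ⟨h0, (hr0 0).ne⟩
  by_cases h : d = r 0
  · obtain ⟨s, hs, -⟩ := exists_prefix_mem_graphSequences G []
    exact ⟨.inl s, hs, .inr ⟨0, hz⟩, trivial, by simp [codeDist, h, (hr0 0).le]⟩
  · refine ⟨.inr ⟨0, hz⟩, trivial, .inr ⟨d, hd, h⟩, trivial, ?_⟩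
    simp only [codeDist, Subtype.mk.injEq]
    split_ifs with h1
    · exact h1
    · exact max_eq_right (hD d hd)

theorem measurableSet_mem_graphSequences (s : List ℕ) :
    MeasurableSet {G : SimpleGraph ℕ | s ∈ graphSequences G} := by
  have hadj : ∀ a b, MeasurableSet {G : SimpleGraph ℕ | G.Adj a b} := fun a b =>
    measurableSet_setOfPred.2 (by fun_prop)
  have : {G : SimpleGraph ℕ | s ∈ graphSequences G} =
      {G | s.length.unpair.1 % 3 = 0 → G ∈ ⋃ (a : ℕ) (b : ℕ),
        {G : SimpleGraph ℕ | s[s.length.unpair.2.unpair.1]? = some a ∧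
          s[s.length.unpair.2.unpair.2]? = some b ∧ G.Adj a b}} ∩
      {_G | s.length.unpair.1 % 3 = 1 →
        s[s.length.unpair.2.unpair.1]? = s[s.length.unpair.2.unpair.2]?} := by
    ext G; simp [graphSequences]
  rw [this]
  refine MeasurableSet.inter ?_ (MeasurableSet.const _)
  refine MeasurableSet.imp (MeasurableSet.const _) ?_
  exact MeasurableSet.iUnion fun a => MeasurableSet.iUnion fun b =>
    (MeasurableSet.const _).inter ((MeasurableSet.const _).inter (hadj a b))

variable {ρ : CodeSpace D (r 0) → UrysohnSpace}

/-- Points added by the closure are not isolated. A point of `D` is at distance at least `r 0 > r 1`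
from the sequences, and three distinct numbers cannot have equal pairwise maxima, so it lies on no
equilateral triangle of side `r 1`. Every sequence in the code is isolated and lies on such a
triangle. -/
theorem isMarked_iff (hr : StrictAnti r) (hD : ∀ x ∈ D, 0 ≤ x) (h0 : ∀ n, 0 < r n)
    (hρ : ∀ v w, dist (ρ v) (ρ w) = codeDist D r v w) (G : SimpleGraph ℕ)
    (x : closure (ρ '' codeSet D (r 0) G)) :
    IsMarked (r 1) x ↔ ∃ s ∈ graphSequences G, ρ (.inl s) = x := by
  have hr' : StrictAnti fun n => r (n + 1) := fun _ _ h => hr (Nat.succ_lt_succ h)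
  have h0' : ∀ n, 0 < r (n + 1) := fun n => h0 _
  have hu : ∀ x ∈ ρ '' codeSet D (r 0) G, ∀ y ∈ ρ '' codeSet D (r 0) G,
      ∀ z ∈ ρ '' codeSet D (r 0) G, dist x z ≤ max (dist x y) (dist y z) := by
    rintro _ ⟨u, -, rfl⟩ _ ⟨v, -, rfl⟩ _ ⟨w, -, rfl⟩
    simp only [hρ]
    exact codeDist_le_max hr hD h0 _ _ _
  have hu' : ∀ x ∈ closure (ρ '' codeSet D (r 0) G), ∀ y ∈ closure (ρ '' codeSet D (r 0) G),
      ∀ z ∈ closure (ρ '' codeSet D (r 0) G), dist x z ≤ max (dist x y) (dist y z) :=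
    fun x hx y hy z hz => dist_le_max_of_mem_closure hu hx hy hz
  obtain ⟨x, hx⟩ := x
  constructor
  · rintro ⟨⟨ε, hε, h1⟩, ⟨p, hp⟩, ⟨q, hq⟩, h2, h3, h4⟩
    change dist x p = r 1 at h2
    change dist x q = r 1 at h3
    change dist p q = r 1 at h4
    obtain ⟨_, ⟨w, hw, rfl⟩, hxw⟩ := Metric.mem_closure_iff.1 hx ε hε
    obtain rfl : ρ w = x :=
      congrArg Subtype.val (h1 ⟨ρ w, subset_closure ⟨w, hw, rfl⟩⟩ hxw)
    rcases w with s | y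
    · exact ⟨s, hw, rfl⟩
    · exfalso
      -- The other two vertices are only limits of coded points; replacing them by coded points
      -- nearer than `r 1` keeps all three sides.
      obtain ⟨_, ⟨w, hw', rfl⟩, hpw⟩ := Metric.mem_closure_iff.1 hp _ (h0 1)
      obtain ⟨_, ⟨v, hv', rfl⟩, hqv⟩ := Metric.mem_closure_iff.1 hq _ (h0 1)
      have hw := subset_closure (Set.mem_image_of_mem ρ hw')
      have hv := subset_closure (Set.mem_image_of_mem ρ hv')
      have e1 := dist_eq_of_dist_lt hu' hp hw hx (by rwa [dist_comm p (ρ (.inr y)), h2])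
      have e2 := dist_eq_of_dist_lt hu' hq hv hx (by rwa [dist_comm q (ρ (.inr y)), h3])
      have e3 := dist_eq_of_dist_lt hu' hp hw hq (by rwa [h4])
      have e4 := dist_eq_of_dist_lt hu' hq hv hw (by rwa [dist_comm q (ρ w), e3, h4])
      rw [dist_comm p, h2, hρ] at e1
      rw [dist_comm q, h3, hρ] at e2
      rw [dist_comm q, e3, h4, hρ] at e4
      have h01 := hr zero_lt_one
      have h1 := h0 1
      rcases w with t | z <;> rcases v with t' | z' <;> simp only [codeDist] at e1 e2 e4
      · exact absurd (le_max_left (r 0) y.1) (by rw [e1]; exact not_le.2 h01)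
      · exact absurd (le_max_left (r 0) y.1) (by rw [e1]; exact not_le.2 h01)
      · exact absurd (le_max_left (r 0) y.1) (by rw [e2]; exact not_le.2 h01)
      · have i1 : z ≠ y := by rintro rfl; rw [if_pos rfl] at e1; linarith
        have i2 : z' ≠ y := by rintro rfl; rw [if_pos rfl] at e2; linarith
        have i3 : z' ≠ z := by rintro rfl; rw [if_pos rfl] at e4; linarith
        rw [if_neg i1] at e1
        rw [if_neg i2] at e2
        rw [if_neg i3] at e4
        have n1 : z.1 ≠ y.1 := fun e => i1 (Subtype.ext e)
        have n2 : z'.1 ≠ y.1 := fun e => i2 (Subtype.ext e)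
        have n3 : z'.1 ≠ z.1 := fun e => i3 (Subtype.ext e)
        rcases max_choice z.1 y.1 with m1 | m1 <;> rcases max_choice z'.1 y.1 with m2 | m2 <;>
          rcases max_choice z'.1 z.1 with m3 | m3 <;> grind
  · rintro ⟨s, hs, rfl⟩
    -- Another sequence agrees with `s` at most up to `s.length`, and the sequences use the radii
    -- shifted by one.
    refine ⟨⟨r (s.length + 1), h0 _, fun ⟨y, hy⟩ hxy => ?_⟩, ?_⟩
    · change dist (ρ (.inl s)) y < _ at hxy
      by_contra hne
      have hne' : dist y (ρ (.inl s)) ≠ 0 := fun e => hne (Subtype.ext (dist_eq_zero.1 e))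
      obtain ⟨_, ⟨w, hw, rfl⟩, hyw⟩ := Metric.mem_closure_iff.1 hy _
        (lt_of_le_of_ne dist_nonneg hne'.symm)
      have e := dist_eq_of_dist_lt hu' hy (subset_closure ⟨w, hw, rfl⟩) hx hyw
      rw [← e, dist_comm, hρ] at hne'
      rw [dist_comm, ← e, dist_comm, hρ] at hxy
      rcases w with t | z
      · simp only [codeDist] at hxy hne'
        have h1 := (sequenceDist_le_iff hr' h0' (s := s) (t := t) (n := s.length)).1 hxy.le
        have hst : s ≠ t := by rintro rfl; exact hne' (sequenceDist_self _)
        obtain ⟨m, hm, hm'⟩ := exists_sequenceDist_eq (r := fun n => r (n + 1)) hst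
        rw [hm, hr'.lt_iff_gt] at hxy
        have h2 := (hm' (s.length + 1)).2 hxy
        have h3 := congrArg List.length h2
        rw [List.length_take, List.length_take] at h3
        rw [List.take_of_length_le (by omega), List.take_of_length_le (by omega)] at h2
        exact hst h2
      · simp only [codeDist] at hxy
        have := hr (Nat.succ_pos s.length)
        exact absurd ((le_max_left _ _).trans_lt hxy) (not_lt.2 this.le)
    -- The first entries of `u` and `v` differ from each other and from that of `s`; if `s` is
    -- empty, its restriction to length 1 is empty and differs from both.
    · obtain ⟨u, hu, -, -, hu1, -⟩ := exists_prefix_mem_graphSequences G [s.headD 0 + 1]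
      obtain ⟨v, hv, -, -, hv1, -⟩ := exists_prefix_mem_graphSequences G [s.headD 0 + 2]
      have hu2 : u.take 1 = [s.headD 0 + 1] := (List.prefix_iff_eq_take.1 hu1).symm
      have hv2 : v.take 1 = [s.headD 0 + 2] := (List.prefix_iff_eq_take.1 hv1).symm
      have key : ∀ a b : List ℕ, a.take 1 ≠ b.take 1 →
          dist (ρ (.inl a)) (ρ (.inl b)) = r 1 := by
        intro a b hab
        rw [hρ]
        exact (sequenceDist_eq_iff hr' h0' (n := 0)).2 ⟨by simp, hab⟩
      refine ⟨⟨ρ (.inl u), subset_closure ⟨_, hu, rfl⟩⟩, ⟨ρ (.inl v), subset_closure ⟨_, hv, rfl⟩⟩,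
        key _ _ ?_, key _ _ ?_, key _ _ ?_⟩
      · rw [hu2]; cases s <;> simp
      · rw [hv2]; cases s <;> simp
      · rw [hu2, hv2]; simp

/-- A graph isomorphism acts on the entries of the sequences and fixes the points of `D`.
Conversely, an isometry preserves marked points and so restricts to an isometric correspondence
between the two codes. -/
theorem borelReducible_graphIsomorphism_uSpacesStar (hDc : D.Countable) (hD : ∀ x ∈ D, 0 ≤ x)
    (hD0 : (0 : ℝ) ∈ D) (hr : StrictAnti r) (hrD : ∀ n, r n ∈ D) :
    BorelReducible GraphIsomorphism (fun U V : USpacesStar D => IsometricSpaces U V) := by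
  have h0 : ∀ n, 0 < r n := hr.pos_of_forall_mem hD hrD
  have : Countable {y : ℝ // y ∈ D ∧ y ≠ r 0} := (hDc.mono fun _ h => h.1).to_subtype
  obtain ⟨ρ, hρ⟩ := UrysohnConstruction.exists_dist_eq (codeDist D r) codeDist_self codeDist_comm
    fun a b c => (codeDist_le_max hr hD h0 a b c).trans
      (max_le_add_of_nonneg (codeDist_nonneg hD h0 _ _) (codeDist_nonneg hD h0 _ _))
  have hu : ∀ G, ∀ x ∈ ρ '' codeSet D (r 0) G, ∀ y ∈ ρ '' codeSet D (r 0) G,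
      ∀ z ∈ ρ '' codeSet D (r 0) G, dist x z ≤ max (dist x y) (dist y z) := by
    rintro G _ ⟨u, -, rfl⟩ _ ⟨v, -, rfl⟩ _ ⟨w, -, rfl⟩
    simp only [hρ]
    exact codeDist_le_max hr hD h0 _ _ _
  have hne := fun G => codeSet_nonempty D (r 0) G
  refine ⟨fun G => ⟨NonemptyClosed.closure (ρ '' codeSet D (r 0) G) ((hne G).image ρ),
    isUltrametricDist_closure _ (hu G), ?_⟩, Measurable.subtype_mk ?_, fun G H => ⟨?_, ?_⟩⟩
  · rw [distanceSet_closure _ (hu G)]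
    ext d
    constructor
    · rintro ⟨_, ⟨v, -, rfl⟩, _, ⟨w, -, rfl⟩, rfl⟩
      rw [hρ]
      exact codeDist_mem hD0 hrD v w
    · intro hd
      obtain ⟨v, hv, w, hw, e⟩ := exists_codeDist_eq hD hD0 h0 G hd
      exact ⟨_, ⟨v, hv, rfl⟩, _, ⟨w, hw, rfl⟩, by rw [hρ, e]⟩
  · refine NonemptyClosed.measurable_closure_image ρ hne fun w => ?_
    rcases w with s | y
    · exact measurableSet_mem_graphSequences s
    · exact MeasurableSet.const _
  · rintro ⟨e⟩
    refine isometricSpaces_closure (ι := codeSet D (r 0) G) ((hne G).image ρ)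
      ((hne H).image ρ) (fun w => ρ w)
      (fun w => ρ (Sum.map (List.map e) id w.1)) (Set.image_eq_range _ _).symm ?_ ?_
    · apply subset_antisymm
      · rintro _ ⟨⟨s | y, hw⟩, rfl⟩
        · exact ⟨_, map_mem_graphSequences e hw, rfl⟩
        · exact ⟨.inr y, trivial, rfl⟩
      · rintro _ ⟨s | y, hw, rfl⟩
        · refine ⟨⟨.inl (s.map e.symm), map_mem_graphSequences e.symm hw⟩, ?_⟩
          simp [Function.comp_def]
        · exact ⟨⟨.inr y, trivial⟩, rfl⟩
    · rintro ⟨s | y, -⟩ ⟨t | z, -⟩ <;>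
        simp [hρ, codeDist, sequenceDist_map e.injective]
  · rintro ⟨f⟩
    change closure (ρ '' codeSet D (r 0) G) ≃ᵢ closure (ρ '' codeSet D (r 0) H) at f
    refine IsIsometricCorrespondence.graphIsomorphism (r := fun n => r (n + 1))
      (E := fun s t => s ∈ graphSequences G ∧ t ∈ graphSequences H ∧
        ∃ x, ρ (.inl s) = x.1 ∧ ρ (.inl t) = (f x).1)
      (fun _ _ h => hr (Nat.succ_lt_succ h)) (fun n => h0 _) ⟨?_, ?_, ?_, ?_⟩
    · intro s hs
      have hm := (isMarked_iff hr hD h0 hρ G ⟨ρ (.inl s), subset_closure ⟨_, hs, rfl⟩⟩).2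
        ⟨s, hs, rfl⟩
      obtain ⟨t, ht, e⟩ := (isMarked_iff hr hD h0 hρ H _).1 (hm.map f)
      exact ⟨t, hs, ht, _, rfl, e⟩
    · intro t ht
      have hm := (isMarked_iff hr hD h0 hρ H ⟨ρ (.inl t), subset_closure ⟨_, ht, rfl⟩⟩).2
        ⟨t, ht, rfl⟩
      obtain ⟨s, hs, e⟩ := (isMarked_iff hr hD h0 hρ G _).1 (hm.map f.symm)
      exact ⟨s, hs, ht, _, e, by rw [f.apply_symm_apply]⟩
    · exact fun s t h => ⟨h.1, h.2.1⟩
    · rintro s t s' t' ⟨-, -, x, h1, h2⟩ ⟨-, -, x', h3, h4⟩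
      have e1 := hρ (.inl s) (.inl s')
      have e2 := hρ (.inl t) (.inl t')
      rw [h1, h3] at e1
      rw [h2, h4] at e2
      exact e1.symm.trans ((f.dist_eq x x').symm.trans e2)

end

/-! ### Measurable selectors -/

theorem NonemptyClosed.measurableSet_inter_nonempty {X : Type*} [TopologicalSpace X] {V : Set X}
    (hV : IsOpen V) : MeasurableSet {F : NonemptyClosed X | (F.carrier ∩ V).Nonempty} :=
  MeasurableSpace.measurableSet_generateFrom ⟨V, hV, rfl⟩

theorem measurable_apply_of_countable {α ι β : Type*} [MeasurableSpace α] [MeasurableSpace β]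
    [MeasurableSpace ι] [MeasurableSingletonClass ι] [Countable ι] {g : ι → α → β} {N : α → ι}
    (hg : ∀ i, Measurable (g i)) (hN : Measurable N) : Measurable fun a => g (N a) a := by
  intro s hs
  have : (fun a => g (N a) a) ⁻¹' s = ⋃ i, (N ⁻¹' {i} ∩ g i ⁻¹' s) := by
    ext a; simp
  rw [this]
  exact MeasurableSet.iUnion fun i => (hN (measurableSet_singleton i)).inter (hg i hs)

section Selectors

variable {X : Type*} [MetricSpace X]

/-- At each step the least suitable index is taken; suitability is expressed by whether the closed
set meets certain open sets, so the choice is Borel. Consecutive balls share a point, which bounds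
the distance of their centres. Starting at `i` whenever possible is what later gives density. -/
theorem exists_measurable_index {p : ℕ → X} (hp : DenseRange p) (i k : ℕ) :
    ∃ N : ℕ → NonemptyClosed X → ℕ, (∀ j, Measurable (N j)) ∧
      (∀ j U, (U.carrier ∩ Metric.ball (p (N j U)) ((1 / 2) ^ (k + j))).Nonempty) ∧
      (∀ j U, dist (p (N j U)) (p (N (j + 1) U)) ≤ 2 * (1 / 2) ^ k * (1 / 2) ^ j) ∧
      ∀ U, (U.carrier ∩ Metric.ball (p i) ((1 / 2) ^ k)).Nonempty → N 0 U = i := by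
  classical
  have meas : ∀ m n : ℕ, MeasurableSet
      {U : NonemptyClosed X | (U.carrier ∩ Metric.ball (p m) ((1 / 2) ^ n)).Nonempty} :=
    fun m n => NonemptyClosed.measurableSet_inter_nonempty Metric.isOpen_ball
  have ex : ∀ (x : X) n, ∃ m, x ∈ Metric.ball (p m) ((1 / 2 : ℝ) ^ n) := fun x n =>
    hp.exists_dist_lt x (by positivity)
  have h0 : ∀ U : NonemptyClosed X, ∃ n,
      (U.carrier ∩ Metric.ball (p n) ((1 / 2) ^ k)).Nonempty ∧
      ((U.carrier ∩ Metric.ball (p i) ((1 / 2) ^ k)).Nonempty → n = i) := by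
    intro U
    by_cases h : (U.carrier ∩ Metric.ball (p i) ((1 / 2) ^ k)).Nonempty
    · exact ⟨i, h, fun _ => rfl⟩
    · obtain ⟨x, hx⟩ := U.nonempty
      obtain ⟨m, hm⟩ := ex x k
      exact ⟨m, ⟨x, hx, hm⟩, fun h' => absurd h' h⟩
  have h1 : ∀ (j m : ℕ) (U : NonemptyClosed X), ∃ n,
      (U.carrier ∩ Metric.ball (p m) ((1 / 2) ^ (k + j))).Nonempty →
      (U.carrier ∩ (Metric.ball (p n) ((1 / 2) ^ (k + (j + 1))) ∩
        Metric.ball (p m) ((1 / 2) ^ (k + j)))).Nonempty := by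
    intro j m U
    by_cases h : (U.carrier ∩ Metric.ball (p m) ((1 / 2) ^ (k + j))).Nonempty
    · obtain ⟨x, hx, hxm⟩ := h
      obtain ⟨n, hn⟩ := ex x (k + (j + 1))
      exact ⟨n, fun _ => ⟨x, hx, hn, hxm⟩⟩
    · exact ⟨0, fun h' => absurd h' h⟩
  let N : ℕ → NonemptyClosed X → ℕ := fun j => Nat.rec (fun U => Nat.find (h0 U))
    (fun j f U => Nat.find (h1 j (f U) U)) j
  have hN0 : ∀ U, N 0 U = Nat.find (h0 U) := fun U => rfl
  have hNs : ∀ j U, N (j + 1) U = Nat.find (h1 j (N j U) U) := fun j U => rfl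
  have hne : ∀ j U, (U.carrier ∩ Metric.ball (p (N j U)) ((1 / 2) ^ (k + j))).Nonempty := by
    intro j U
    induction j with
    | zero => exact (Nat.find_spec (h0 U)).1
    | succ j ih =>
      rw [hNs]
      exact (Nat.find_spec (h1 j (N j U) U) ih).mono
        (Set.inter_subset_inter_right _ Set.inter_subset_left)
  refine ⟨N, fun j => ?_, hne, fun j U => ?_, fun U => (Nat.find_spec (h0 U)).2⟩
  · induction j with
    | zero =>
      exact measurable_find h0 fun n => (meas n k).inter
        (MeasurableSet.imp (meas i k) (MeasurableSet.const _))
    | succ j ih =>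
      exact measurable_apply_of_countable (g := fun m U => Nat.find (h1 j m U))
        (fun m => measurable_find (h1 j m) fun n => MeasurableSet.imp (meas m _)
          (NonemptyClosed.measurableSet_inter_nonempty (Metric.isOpen_ball.inter
            Metric.isOpen_ball))) ih
  · obtain ⟨x, -, hx1, hx2⟩ := Nat.find_spec (h1 j (N j U) U) (hne j U)
    rw [← hNs, Metric.mem_ball] at hx1
    rw [Metric.mem_ball] at hx2
    have := dist_triangle_left (p (N j U)) (p (N (j + 1) U)) x
    have e : (1 / 2 : ℝ) ^ (k + (j + 1)) = (1 / 2) ^ k * (1 / 2) ^ j / 2 := by ring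
    rw [e] at hx1
    rw [pow_add] at hx2
    have : (0 : ℝ) < (1 / 2) ^ k * (1 / 2) ^ j := by positivity
    linarith

/-- For each starting index `i` and initial radius `(1 / 2) ^ k`, the centres converge to a point of
the closed set. -/
theorem exists_measurable_dense_selectors [CompleteSpace X]
    [TopologicalSpace.SeparableSpace X] [MeasurableSpace X] [BorelSpace X] :
    ∃ s : ℕ → NonemptyClosed X → X, (∀ n, Measurable (s n)) ∧ (∀ n U, s n U ∈ U.carrier) ∧
      ∀ U, U.carrier ⊆ closure (Set.range fun n => s n U) := by
  rcases isEmpty_or_nonempty X with hX | hX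
  · have : IsEmpty (NonemptyClosed X) := ⟨fun U => hX.elim U.nonempty.some⟩
    exact ⟨fun _ U => isEmptyElim U, fun n => measurable_of_empty _, fun n U => isEmptyElim U,
      fun U => isEmptyElim U⟩
  have hp := TopologicalSpace.denseRange_denseSeq X
  set p := TopologicalSpace.denseSeq X
  choose N hN1 hN2 hN3 hN4 using fun i k => exists_measurable_index hp i k
  have hlim : ∀ i k U, ∃ x, Tendsto (fun j => p (N i k j U)) atTop (𝓝 x) := fun i k U =>
    cauchySeq_tendsto_of_complete
      (cauchySeq_of_le_geometric (1 / 2) (2 * (1 / 2) ^ k) (by norm_num) fun j => hN3 i k j U)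
  choose L hL using hlim
  refine ⟨fun n => L n.unpair.1 n.unpair.2, fun n => ?_, fun n U => ?_, fun U x hx => ?_⟩
  · refine measurable_of_tendsto_metrizable (f := fun j U => p (N _ _ j U)) (fun j => ?_)
      (tendsto_pi_nhds.2 fun U => hL _ _ U)
    exact (measurable_from_nat (f := p)).comp (hN1 _ _ j)
  · change L n.unpair.1 n.unpair.2 U ∈ U.carrier
    generalize n.unpair.1 = i
    generalize n.unpair.2 = k
    choose u hu hu' using fun j => hN2 i k j U
    refine U.isClosed.mem_of_tendsto (f := u) (b := atTop) ?_ (Eventually.of_forall hu)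
    refine (tendsto_iff_of_dist ?_).2 (hL i k U)
    refine squeeze_zero (fun _ => dist_nonneg) (fun j => (Metric.mem_ball.1 (hu' j)).le) ?_
    simp only [pow_add]
    simpa using (tendsto_pow_atTop_nhds_zero_of_lt_one (r := (1 / 2 : ℝ)) (by norm_num)
      (by norm_num)).const_mul ((1 / 2 : ℝ) ^ k)
  · refine Metric.mem_closure_iff.2 fun ε hε => ?_
    -- The point `p i` is within `(1 / 2) ^ k` of `x`, and the limit is within `4 * (1 / 2) ^ k` of
    -- `p i`.
    obtain ⟨k, hk⟩ := exists_pow_lt_of_lt_one (show 0 < ε / 5 by linarith)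
      (show (1 / 2 : ℝ) < 1 by norm_num)
    obtain ⟨i, hi⟩ := hp.exists_dist_lt x (show (0 : ℝ) < (1 / 2) ^ k by positivity)
    refine ⟨_, ⟨Nat.pair i k, rfl⟩, ?_⟩
    simp only [Nat.unpair_pair]
    have h0 : N i k 0 U = i := hN4 i k U ⟨x, hx, hi⟩
    have h1 := dist_le_of_le_geometric_of_tendsto₀ (1 / 2) (2 * (1 / 2) ^ k) (by norm_num)
      (fun j => hN3 i k j U) (hL i k U)
    rw [h0, show 2 * (1 / 2 : ℝ) ^ k / (1 - 1 / 2) = 4 * (1 / 2) ^ k by ring] at h1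
    have := dist_triangle x (p i) (L i k U)
    linarith

end Selectors

/-! ### From ultrametric spaces to graphs -/

/-- The ball of radius `q c` around `x n` is coded by the vertices `((n, k), c)`, for all `k`; balls
which meet are adjacent, and balls of radius `q c` are adjacent to the vertex `c + 1` of a ray. -/
def ballGraph {X : Type*} [MetricSpace X] (x : ℕ → X) (q : ℕ → ℝ) :
    SimpleGraph (ℕ ⊕ (ℕ × ℕ) × ℕ) where
  Adj
    | .inl i, .inl j => i = j + 1 ∨ j = i + 1
    | .inl i, .inr b => i = b.2 + 1
    | .inr b, .inl i => i = b.2 + 1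
    | .inr b, .inr b' => b ≠ b' ∧ dist (x b.1.1) (x b'.1.1) < max (q b.2) (q b'.2)
  symm := ⟨by
    rintro (i | b) (j | b') h
    · exact h.symm
    · exact h
    · exact h
    · exact ⟨h.1.symm, by rw [dist_comm, max_comm]; exact h.2⟩⟩
  loopless := ⟨by
    rintro (i | b) h
    · rcases h with h | h <;> omega
    · exact h.1 rfl⟩

/-- Over each common value both fibres are countably infinite, hence equinumerous. This is why each
ball has infinitely many vertices in `ballGraph`. -/
theorem exists_equiv_of_fibers {A B Q : Type*} [Countable A] [Countable B] (f : A → Q) (g : B → Q)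
    (hf : ∀ a, Infinite {a' // f a' = f a}) (hg : ∀ b, Infinite {b' // g b' = g b})
    (h : Set.range f = Set.range g) : ∃ e : A ≃ B, ∀ a, g (e a) = f a := by
  have : ∀ q, Nonempty ({a // f a = q} ≃ {b // g b = q}) := by
    intro q
    by_cases hq : q ∈ Set.range f
    · obtain ⟨b, hb⟩ := h ▸ hq
      obtain ⟨a, ha⟩ := hq
      have := hf a
      have := hg b
      rw [ha] at *
      rw [hb] at *
      exact nonempty_equiv_of_countable
    · have h1 : IsEmpty {a // f a = q} := ⟨fun a => hq ⟨a, a.2⟩⟩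
      have h2 : IsEmpty {b // g b = q} := ⟨fun b => hq (h ▸ ⟨b.1, b.2⟩)⟩
      exact ⟨Equiv.equivOfIsEmpty _ _⟩
  let e := fun q => (this q).some
  refine ⟨(Equiv.sigmaFiberEquiv f).symm.trans
    ((Equiv.sigmaCongrRight e).trans (Equiv.sigmaFiberEquiv g)), fun a => ?_⟩
  exact (e (f a) ⟨a, rfl⟩).2

section

variable {X Y : Type*} [MetricSpace X] [MetricSpace Y]

theorem dist_lt_iff_of_dist_lt [IsUltrametricDist Y] {a a' b b' : Y} {c : ℝ}
    (h : dist a a' < c) (h' : dist b b' < c) :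
    dist a b < c ↔ dist a' b' < c := by
  have key : ∀ {a a' b b' : Y}, dist a a' < c → dist b b' < c → dist a b < c → dist a' b' < c := by
    intro a a' b b' h h' hab
    rw [dist_comm] at h
    exact (dist_triangle_max a' a b').trans_lt
      (max_lt h ((dist_triangle_max a b b').trans_lt (max_lt hab h')))
  exact ⟨key h h', key (by rwa [dist_comm]) (by rwa [dist_comm])⟩

/-- Every point of an ultrametric ball is a centre of it, so any two dense sequences list the same
balls of radius `q c`. Vertices coding equal balls are matched; adjacency does not depend on the
chosen centres. -/
theorem nonempty_ballGraph_iso [IsUltrametricDist Y] {x : ℕ → X} {y : ℕ → Y}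
    (hx : DenseRange x) (hy : DenseRange y) (f : X ≃ᵢ Y) {q : ℕ → ℝ} (hq : ∀ c, 0 < q c) :
    Nonempty (ballGraph x q ≃g ballGraph y q) := by
  have hfx : DenseRange (f ∘ x) := f.surjective.denseRange.comp hx f.continuous
  have inf : ∀ (z : ℕ → Y) c (a : ℕ × ℕ),
      Infinite {a' : ℕ × ℕ // Metric.ball (z a'.1) (q c) = Metric.ball (z a.1) (q c)} := by
    intro z c a
    refine Infinite.of_injective (fun k : ℕ => ⟨(a.1, k), rfl⟩) fun k l h => ?_
    simpa using h
  have ball_eq : ∀ {a b : Y} {c}, dist a b < c → Metric.ball a c = Metric.ball b c := by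
    intro a b c h
    ext z
    rw [Metric.mem_ball, Metric.mem_ball]
    exact dist_lt_iff_of_dist_lt (by simpa using dist_nonneg.trans_lt h) h
  have sub : ∀ {z w : ℕ → Y} c, DenseRange w →
      Set.range (fun a : ℕ × ℕ => Metric.ball (z a.1) (q c)) ⊆
      Set.range (fun a : ℕ × ℕ => Metric.ball (w a.1) (q c)) := by
    rintro z w c hw _ ⟨a, rfl⟩
    obtain ⟨m, hm⟩ := hw.exists_dist_lt (z a.1) (hq c)
    exact ⟨(m, 0), (ball_eq hm).symm⟩
  have key := fun c => exists_equiv_of_fibers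
    (fun a : ℕ × ℕ => Metric.ball (f (x a.1)) (q c)) (fun a : ℕ × ℕ => Metric.ball (y a.1) (q c))
    (inf (fun n => f (x n)) c) (inf y c) ((sub c hy).antisymm (sub c hfx))
  choose e he using key
  have hd : ∀ a c, dist (y (e c a).1) (f (x a.1)) < q c := fun a c => by
    rw [← Metric.mem_ball, ← he]; exact Metric.mem_ball_self (hq c)
  refine ⟨⟨(Equiv.refl ℕ).sumCongr (Equiv.prodCongrLeft e), ?_⟩⟩
  rintro (i | ⟨a, c⟩) (j | ⟨a', c'⟩)
  · exact Iff.rfl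
  · exact Iff.rfl
  · exact Iff.rfl
  · change (_ ∧ dist (y (e c a).1) (y (e c' a').1) < max (q c) (q c')) ↔
      (_ ∧ dist (x a.1) (x a'.1) < max (q c) (q c'))
    refine and_congr (not_congr (Equiv.prodCongrLeft e).injective.eq_iff) ?_
    rw [dist_lt_iff_of_dist_lt (lt_max_of_lt_left (hd a c)) (lt_max_of_lt_right (hd a' c')),
      f.dist_eq]

/-- The start of the ray is the only vertex with a single neighbour. Inductively, the next vertex of
the ray is the only new neighbour having no common neighbour with the current one: a ball vertex
attached there forms a triangle with another copy of the same ball. -/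
theorem ballGraph_iso_inl {x : ℕ → X} {y : ℕ → Y} {q : ℕ → ℝ} (hq : ∀ c, 0 < q c)
    (φ : ballGraph x q ≃g ballGraph y q) (i : ℕ) : φ (.inl i) = .inl i := by
  have nbr : ∀ b c, (ballGraph y q).Adj (.inr (b, c)) (.inr ((b.1, b.2 + 1), c)) := fun b c =>
    ⟨by simp [Prod.ext_iff], by simpa using hq c⟩
  have h0 : φ (.inl 0) = .inl 0 := by
    have h1 : ∀ u v, (ballGraph y q).Adj (φ (.inl 0)) u → (ballGraph y q).Adj (φ (.inl 0)) v →
        u = v := by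
      have : ∀ u, (ballGraph x q).Adj (.inl 0) u → u = .inl 1 := by
        rintro (j | b) h
        · rcases h with h | h
          · omega
          · rw [h]
        · change 0 = b.2 + 1 at h
          omega
      intro u v hu hv
      obtain ⟨u, rfl⟩ := φ.surjective u
      obtain ⟨v, rfl⟩ := φ.surjective v
      rw [this u (φ.map_rel_iff.1 hu), this v (φ.map_rel_iff.1 hv)]
    rcases hφ : φ (.inl 0) with i | ⟨b, c⟩ <;> rw [hφ] at h1
    · rcases i with - | i
      · rfl
      · have := h1 (.inl i) (.inl (i + 2)) (Or.inl rfl) (Or.inr rfl)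
        simp at this
    · have := h1 _ (.inl (c + 1)) (nbr b c) rfl
      simp at this
  have key : ∀ i, ∀ j ≤ i, φ (.inl j) = .inl j := by
    intro i
    induction i with
    | zero => intro j hj; rwa [Nat.le_zero.1 hj]
    | succ i ih =>
      intro j hj
      rcases hj.lt_or_eq with hj | rfl
      · exact ih j (by omega)
      have h1 : (ballGraph y q).Adj (.inl i) (φ (.inl (i + 1))) := by
        rw [← ih i le_rfl]
        exact φ.map_rel_iff.2 (Or.inr rfl)
      have h2 : ∀ w, (ballGraph y q).Adj (.inl i) w →
          ¬(ballGraph y q).Adj (φ (.inl (i + 1))) w := by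
        intro w hw hw'
        obtain ⟨w, rfl⟩ := φ.surjective w
        rw [← ih i le_rfl] at hw
        replace hw := φ.map_rel_iff.1 hw
        replace hw' := φ.map_rel_iff.1 hw'
        rcases w with j | b
        · rcases hw with hw | hw <;> rcases hw' with hw' | hw' <;> omega
        · change i = b.2 + 1 at hw
          change i + 1 = b.2 + 1 at hw'
          omega
      rcases hφ : φ (.inl (i + 1)) with j | ⟨b, c⟩ <;> rw [hφ] at h1 h2
      · rcases h1 with h1 | h1
        · have := φ.injective ((ih j (by omega)).trans hφ.symm)
          simp at this
          omega
        · rw [h1]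
      · exact absurd (nbr b c) (h2 _ (by exact h1))
  exact key i i le_rfl

theorem ballGraph_iso_inr {x : ℕ → X} {y : ℕ → Y} {q : ℕ → ℝ} (hq : ∀ c, 0 < q c)
    (φ : ballGraph x q ≃g ballGraph y q) (a : ℕ × ℕ) (c : ℕ) :
    ∃ b, φ (.inr (a, c)) = .inr (b, c) := by
  rcases hφ : φ (.inr (a, c)) with j | ⟨b, c'⟩
  · rw [← ballGraph_iso_inl hq φ j] at hφ
    simpa using φ.injective hφ
  · have h1 : (ballGraph y q).Adj (φ (.inl (c + 1))) (φ (.inr (a, c))) := φ.map_rel_iff.2 rfl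
    rw [ballGraph_iso_inl hq, hφ] at h1
    change c + 1 = c' + 1 at h1
    exact ⟨b, by rw [show c = c' by omega]⟩

/-- Since the ray is fixed, each radius index is preserved, and adjacency tells whether a distance
is below a radius. The radii are dense in the positive reals, so these comparisons determine all
distances. -/
theorem nonempty_isometryEquiv_of_ballGraph_iso [IsUltrametricDist Y] [CompleteSpace X]
    [CompleteSpace Y] {x : ℕ → X} {y : ℕ → Y} (hx : DenseRange x)
    (hy : DenseRange y) {q : ℕ → ℝ} (hq : ∀ c, 0 < q c)
    (hq' : ∀ a b : ℝ, 0 ≤ a → a < b → ∃ c, a < q c ∧ q c < b)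
    (φ : ballGraph x q ≃g ballGraph y q) : Nonempty (X ≃ᵢ Y) := by
  choose ψ hψ using ballGraph_iso_inr hq φ
  have key : ∀ a c a' c', dist (x a.1) (x a'.1) < max (q c) (q c') ↔
      dist (y (ψ a c).1) (y (ψ a' c').1) < max (q c) (q c') := by
    intro a c a' c'
    by_cases h : (a, c) = (a', c')
    · obtain ⟨rfl, rfl⟩ := Prod.ext_iff.1 h
      simp
    have h' : (ψ a c, c) ≠ (ψ a' c', c') := by
      intro h'
      have := φ.injective ((hψ a c).trans (h' ▸ (hψ a' c').symm))
      exact h (Sum.inr_injective this)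
    have : (ballGraph y q).Adj _ _ ↔ (ballGraph x q).Adj _ _ :=
      φ.map_rel_iff (a := .inr (a, c)) (b := .inr (a', c'))
    rw [hψ, hψ] at this
    change (_ ∧ _) ↔ (_ ∧ _) at this
    simpa [h, h'] using this.symm
  have surj : ∀ b c, ∃ a, ψ a c = b := by
    intro b c
    obtain ⟨v, hv⟩ := φ.surjective (.inr (b, c))
    rcases v with i | ⟨a, c'⟩
    · rw [ballGraph_iso_inl hq] at hv
      simp at hv
    · rw [hψ] at hv
      obtain ⟨h1, h2⟩ := Prod.ext_iff.1 (Sum.inr_injective hv)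
      obtain rfl : c' = c := h2
      exact ⟨a, h1⟩
  -- `z n c` is a centre of the ball corresponding to the ball of radius `q c` around `x n`. Along
  -- radii tending to zero these centres converge to the image `F n` of `x n`.
  set z : ℕ → ℕ → Y := fun n c => y (ψ (n, 0) c).1 with hz
  have z1 : ∀ n c c', dist (z n c) (z n c') < max (q c) (q c') := fun n c c' =>
    (key (n, 0) c (n, 0) c').1 (by simp [hq])
  have z2 : ∀ n m c, dist (x n) (x m) < q c ↔ dist (z n c) (z m c) < q c := fun n m c => by
    simpa using key (n, 0) c (m, 0) c
  have z3 : ∀ m c, ∃ n, dist (z n c) (y m) < q c := by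
    intro m c
    obtain ⟨a, ha⟩ := surj (m, 0) c
    refine ⟨a.1, ?_⟩
    have := (key (a.1, 0) c a c).1 (by simp [hq])
    rwa [ha, max_self] at this
  choose u hu0 hu using fun j : ℕ => hq' 0 (1 / ((j : ℝ) + 1)) le_rfl Nat.one_div_pos_of_nat
  have hlim : Tendsto (fun j => q (u j)) atTop (𝓝 0) :=
    squeeze_zero (fun j => (hu0 j).le) (fun j => (hu j).le) tendsto_one_div_add_atTop_nhds_zero_nat
  have hc : ∀ n, ∃ w, Tendsto (fun j => z n (u j)) atTop (𝓝 w) := by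
    intro n
    refine cauchySeq_tendsto_of_complete (Metric.cauchySeq_iff.2 fun ε hε => ?_)
    obtain ⟨N, hN⟩ := (hlim.eventually (gt_mem_nhds hε)).exists_forall_of_atTop
    exact ⟨N, fun i hi j hj => (z1 n _ _).trans (max_lt (hN i hi) (hN j hj))⟩
  choose F hF using hc
  have F1 : ∀ n c, dist (F n) (z n c) < q c := by
    intro n c
    obtain ⟨j, h1, h2⟩ := (((Metric.tendsto_nhds.1 (hF n)) _ (hq c)).and
      (hlim.eventually (gt_mem_nhds (hq c)))).exists
    rw [dist_comm] at h1
    exact (dist_triangle_max _ (z n (u j)) _).trans_lt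
      (max_lt h1 ((z1 n _ _).trans_le (max_le h2.le le_rfl)))
  have F2 : ∀ n m c, dist (x n) (x m) < q c ↔ dist (F n) (F m) < q c := fun n m c => by
    rw [z2, dist_lt_iff_of_dist_lt (F1 n c) (F1 m c)]
  refine nonempty_isometryEquiv_of_dense hx (y := F) ?_ fun n m => le_antisymm ?_ ?_
  · refine Metric.denseRange_iff.2 fun w ε hε => ?_
    obtain ⟨c, h0, hc⟩ := hq' 0 ε le_rfl hε
    obtain ⟨m, hm⟩ := hy.exists_dist_lt w (hq c)
    obtain ⟨n, hn⟩ := z3 m c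
    refine ⟨n, lt_trans ?_ hc⟩
    rw [dist_lt_iff_of_dist_lt hm (F1 n c), dist_comm]
    exact hn
  · by_contra! h
    obtain ⟨c, h1, h2⟩ := hq' _ _ dist_nonneg h
    exact ((F2 n m c).2 h1).not_gt h2
  · by_contra! h
    obtain ⟨c, h1, h2⟩ := hq' _ _ dist_nonneg h
    exact ((F2 n m c).1 h1).not_gt h2

end

theorem borelReducible_uSpaces_graphIsomorphism (D : Set ℝ) :
    BorelReducible (fun U V : USpaces D => IsometricSpaces U V) GraphIsomorphism := by
  let := borel UrysohnSpace
  have : BorelSpace UrysohnSpace := ⟨rfl⟩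
  obtain ⟨s, hs, hsU, hsd⟩ := exists_measurable_dense_selectors (X := UrysohnSpace)
  obtain ⟨g, hg⟩ := exists_surjective_nat {a : ℚ // 0 < a}
  obtain ⟨e⟩ : Nonempty (ℕ ≃ ℕ ⊕ (ℕ × ℕ) × ℕ) := nonempty_equiv_of_countable
  set q : ℕ → ℝ := fun c => ((g c).1 : ℝ) with hqdef
  have hq : ∀ c, 0 < q c := fun c => Rat.cast_pos.2 (g c).2
  have hq' : ∀ a b : ℝ, 0 ≤ a → a < b → ∃ c, a < q c ∧ q c < b := by
    intro a b ha hab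
    obtain ⟨t, h1, h2⟩ := exists_rat_btwn hab
    obtain ⟨c, hc⟩ := hg ⟨t, by exact_mod_cast ha.trans_lt h1⟩
    exact ⟨c, by simp [hqdef, hc, h1], by simp [hqdef, hc, h2]⟩
  let x : ∀ U : NonemptyClosed UrysohnSpace, ℕ → U.carrier := fun U n => ⟨s n U, hsU n U⟩
  have hx : ∀ U, DenseRange (x U) := by
    intro U
    rw [DenseRange, Subtype.dense_iff, ← Set.range_comp]
    exact hsd U
  refine ⟨fun U => (ballGraph (x U) q).comap e, ?_, fun U V => ?_⟩
  · refine SimpleGraph.measurable_iff_adj.2 fun a b => ?_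
    simp only [SimpleGraph.comap_adj]
    rcases e a with i | v <;> rcases e b with j | w
    · exact measurable_const
    · exact measurable_const
    · exact measurable_const
    · refine measurable_const.and (measurableSet_setOfPred.1 (measurableSet_lt ?_ measurable_const))
      exact ((hs _).comp measurable_subtype_coe).dist ((hs _).comp measurable_subtype_coe)
  · have := U.2.1
    have := V.2.1
    have : CompleteSpace U.1.carrier := U.1.isClosed.completeSpace_coe
    have : CompleteSpace V.1.carrier := V.1.isClosed.completeSpace_coe
    have iso : ∀ W : NonemptyClosed UrysohnSpace,
        (ballGraph (x W) q).comap e ≃g ballGraph (x W) q := fun W => SimpleGraph.Iso.comap e _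
    constructor
    · rintro ⟨f⟩
      obtain ⟨φ⟩ := nonempty_ballGraph_iso (hx U) (hx V) f hq
      exact ⟨(iso U).trans (φ.trans (iso V).symm)⟩
    · rintro ⟨φ⟩
      exact nonempty_isometryEquiv_of_ballGraph_iso (hx U) (hx V) hq hq'
        ((iso U).symm.trans (φ.trans (iso V)))

/-! ### Isometric maps between trees of sequences -/

/-- Correct the map `F` on sequences, which preserves the sequence distance, to a map which
preserves the lengths and the extension relation, by undoing exchanges of a sequence and an
extension of it by one entry. -/
def treeMap (F : List ℕ → List ℕ) (s : List ℕ) : List ℕ :=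
  (if (F s).length ≤ s.dropLast.length then F s.dropLast else F s).take s.length

theorem treeMap_nil (F : List ℕ → List ℕ) : treeMap F [] = [] := by simp [treeMap]

theorem treeMap_concat (F : List ℕ → List ℕ) (s : List ℕ) (k : ℕ) : treeMap F (s ++ [k]) =
    (if (F (s ++ [k])).length ≤ s.length then F s else F (s ++ [k])).take (s.length + 1) := by
  simp [treeMap]

theorem List.eq_of_take_eq_of_length_lt {α : Type*} {s t : List α} {n : ℕ}
    (h : s.take n = t.take n) (hs : s.length < n) : s = t := by
  have hl := congrArg List.length h
  rw [List.length_take, List.length_take] at hl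
  rwa [List.take_of_length_le hs.le, List.take_of_length_le (by omega)] at h

/-- `F` is an isometric map from `S` to `T`, which are closed under restriction. -/
structure IsTreeIsometry (S T : Set (List ℕ)) (F : List ℕ → List ℕ) : Prop where
  left : ∀ s ∈ S, ∀ t, t <+: s → t ∈ S
  right : ∀ s ∈ T, ∀ t, t <+: s → t ∈ T
  mapsTo : ∀ s ∈ S, F s ∈ T
  take_iff : ∀ s ∈ S, ∀ t ∈ S, ∀ n, (F s).take n = (F t).take n ↔ s.take n = t.take n
  inj : ∀ s ∈ S, ∀ t ∈ S, F s = F t → s = t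

namespace IsTreeIsometry

variable {S T : Set (List ℕ)} {F : List ℕ → List ℕ} (h : IsTreeIsometry S T F) {s t : List ℕ}
  {k : ℕ}

include h

theorem mem_of_concat (hk : s ++ [k] ∈ S) : s ∈ S := h.left _ hk _ (List.prefix_append _ _)

theorem take_concat (hk : s ++ [k] ∈ S) :
    (F (s ++ [k])).take s.length = (F s).take s.length :=
  (h.take_iff _ hk _ (h.mem_of_concat hk) _).2 (by simp)

theorem ne_concat (hk : s ++ [k] ∈ S) : F (s ++ [k]) ≠ F s := fun e => by
  simpa using h.inj _ hk _ (h.mem_of_concat hk) e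

theorem length_le (hk : s ++ [k] ∈ S) : s.length ≤ (F s).length := by
  by_contra! hlt
  exact h.ne_concat hk (List.eq_of_take_eq_of_length_lt (h.take_concat hk).symm hlt).symm

theorem treeMap_eq_take (hk : s ++ [k] ∈ S) : treeMap F s = (F s).take s.length := by
  rcases List.eq_nil_or_concat' s with rfl | ⟨s', k', rfl⟩
  · simp [treeMap]
  · have := h.length_le hk
    rw [List.length_append, List.length_singleton] at this
    rw [treeMap_concat, if_neg (by omega)]
    simp

/-- A sequence and its extension have distinct images that agree up to `s.length`, so the two images
cannot both be that short. When the extension has a short image, the image of `s` is long and can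
take its place in `treeMap`. -/
theorem lt_length_of_concat_le (hk : s ++ [k] ∈ S) (hl : (F (s ++ [k])).length ≤ s.length) :
    s.length < (F s).length := by
  by_contra! hle
  have := h.take_concat hk
  rw [List.take_of_length_le hl, List.take_of_length_le hle] at this
  exact h.ne_concat hk this

theorem exists_treeMap_concat (hk : s ++ [k] ∈ S) :
    ∃ j, treeMap F (s ++ [k]) = treeMap F s ++ [j] := by
  rw [treeMap_concat, h.treeMap_eq_take hk]
  split_ifs with hl
  · have := h.lt_length_of_concat_le hk hl
    exact ⟨_, List.take_succ_eq_append_getElem this⟩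
  · rw [List.take_succ_eq_append_getElem (by omega), h.take_concat hk]
    exact ⟨_, rfl⟩

theorem length_treeMap (hs : s ∈ S) : (treeMap F s).length = s.length := by
  induction s using List.reverseRecOn with
  | nil => simp [treeMap_nil]
  | append_singleton s k ih =>
    obtain ⟨j, hj⟩ := h.exists_treeMap_concat hs
    rw [hj, List.length_append, List.length_append, ih (h.mem_of_concat hs)]
    rfl

theorem treeMap_mem (hs : s ∈ S) : treeMap F s ∈ T := by
  rcases List.eq_nil_or_concat' s with rfl | ⟨s', k, rfl⟩
  · rw [treeMap_nil]
    exact h.right _ (h.mapsTo _ hs) _ List.nil_prefix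
  · rw [treeMap_concat]
    split_ifs
    · exact h.right _ (h.mapsTo _ (h.mem_of_concat hs)) _ (List.take_prefix _ _)
    · exact h.right _ (h.mapsTo _ hs) _ (List.take_prefix _ _)

/-- If neither extension is replaced, agreement of the images up to `s.length + 1` gives `k = k'`.
If both are, their short images coincide and injectivity of `F` applies. If only one is, `s` would
agree with a proper extension of itself by one entry. -/
theorem treeMap_concat_inj {k' : ℕ} (hk : s ++ [k] ∈ S) (hk' : s ++ [k'] ∈ S)
    (e : treeMap F (s ++ [k]) = treeMap F (s ++ [k'])) : k = k' := by
  have hs := h.mem_of_concat hk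
  have key : ∀ t ∈ S, ∀ t' ∈ S, (F t).take (s.length + 1) = (F t').take (s.length + 1) →
    t.take (s.length + 1) = t'.take (s.length + 1) := fun t ht t' ht' =>
      (h.take_iff t ht t' ht' _).1
  rw [treeMap_concat, treeMap_concat] at e
  split_ifs at e with h1 h2 h2
  · have e1 := h.take_concat hk
    have e2 := h.take_concat hk'
    rw [List.take_of_length_le h1] at e1
    rw [List.take_of_length_le h2] at e2
    simpa using h.inj _ hk _ hk' (e1.trans e2.symm)
  · simpa [List.take_append] using key _ hs _ hk' e
  · simpa [List.take_append] using key _ hk _ hs e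
  · simpa [List.take_append] using key _ hk _ hk' e

theorem treeMap_injOn : Set.InjOn (treeMap F) S := by
  intro s
  induction s using List.reverseRecOn with
  | nil =>
    intro hs t ht e
    have := congrArg List.length e
    rw [h.length_treeMap hs, h.length_treeMap ht] at this
    exact (List.eq_nil_of_length_eq_zero this.symm).symm
  | append_singleton s k ih =>
    intro hs t ht e
    rcases List.eq_nil_or_concat' t with rfl | ⟨t, k', rfl⟩
    · have := congrArg List.length e
      rw [h.length_treeMap hs, h.length_treeMap ht] at this
      simp at this
    · obtain ⟨j, hj⟩ := h.exists_treeMap_concat hs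
      obtain ⟨j', hj'⟩ := h.exists_treeMap_concat ht
      have e' := e
      rw [hj, hj'] at e'
      obtain rfl := ih (h.mem_of_concat hs) (h.mem_of_concat ht) (List.append_inj_left' e' rfl)
      rw [h.treeMap_concat_inj hs ht e]

/-- The preimages `x` of the extended sequence and `v` of `treeMap F s` are distinct. They lie in
the cone of `s` and yield the required extension of `s`, unless `treeMap` has replaced the image of
`s`. -/
theorem exists_treeMap_concat_eq (hF : ∀ t ∈ T, ∃ s ∈ S, F s = t) (hs : s ∈ S) {j : ℕ}
    (hj : treeMap F s ++ [j] ∈ T) :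
    ∃ k, s ++ [k] ∈ S ∧ treeMap F (s ++ [k]) = treeMap F s ++ [j] := by
  have hlen := h.length_treeMap hs
  obtain ⟨x, hx, hxy⟩ := hF _ hj
  obtain ⟨v, hv, hvu⟩ := hF _ (h.treeMap_mem hs)
  have hvx : v ≠ x := by
    rintro rfl
    simpa using hvu.symm.trans hxy
  have hxt : (F x).take s.length = treeMap F s := by rw [hxy, ← hlen, List.take_left']; rfl
  have hvt : (F v).take s.length = treeMap F s := by rw [hvu, ← hlen, List.take_length]
  by_cases hgood : (F s).take s.length = treeMap F s
  · have hxs : x.take s.length = s := by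
      rw [(h.take_iff x hx s hs _).1 (hxt.trans hgood.symm), List.take_length]
    have hvs : v.take s.length = s := by
      rw [(h.take_iff v hv s hs _).1 (hvt.trans hgood.symm), List.take_length]
    have ext : ∀ z ∈ S, z.take s.length = s → z ≠ s → ∃ k, s ++ [k] ∈ S ∧
        (F (s ++ [k])).take (s.length + 1) = (F z).take (s.length + 1) := by
      intro z hz hzs hne
      have hl : s.length < z.length := by
        by_contra! hle
        rw [List.take_of_length_le hle] at hzs
        exact hne hzs
      have e : z.take (s.length + 1) = s ++ [z[s.length]] := by
        rw [List.take_succ_eq_append_getElem hl, hzs]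
      have hm : s ++ [z[s.length]] ∈ S := e ▸ h.left z hz _ (List.take_prefix _ _)
      refine ⟨_, hm, (h.take_iff _ hm _ hz _).2 ?_⟩
      rw [e, List.take_of_length_le (by simp)]
    -- If `x = s`, the extension of `s` towards `v` has the short image `treeMap F s`, so `treeMap`
    -- replaces it by `F s`, which is the target.
    by_cases hne : x = s
    · subst hne
      obtain ⟨k, hk, e⟩ := ext v hv hvs hvx
      refine ⟨k, hk, ?_⟩
      have hl : (F (x ++ [k])).length ≤ x.length := by
        rw [hvu, List.take_of_length_le (by omega : (treeMap F x).length ≤ x.length + 1)] at e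
        have := congrArg List.length e
        rw [List.length_take] at this
        omega
      rw [treeMap_concat, if_pos hl, hxy, List.take_of_length_le (by simp [hlen])]
    · obtain ⟨k, hk, e⟩ := ext x hx hxs hne
      refine ⟨k, hk, ?_⟩
      rw [hxy, List.take_of_length_le (l := treeMap F s ++ [j]) (by simp [hlen])] at e
      have hl : s.length < (F (s ++ [k])).length := by
        have := congrArg List.length e
        rw [List.length_take, List.length_append, List.length_singleton] at this
        omega
      rw [treeMap_concat, if_neg (by omega), e]
  -- Here `treeMap F s` comes from the image of the parent `s'`. Then `x` and `v` both agree with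
  -- `s'` beyond its length, so both equal `s'`.
  · exfalso
    rcases List.eq_nil_or_concat' s with rfl | ⟨s', k', rfl⟩
    · simp [treeMap_nil] at hgood
    · have hs' := h.mem_of_concat hs
      have e : treeMap F (s' ++ [k']) = (F s').take (s' ++ [k']).length := by
        rw [treeMap_concat] at hgood ⊢
        split_ifs at hgood ⊢ with hl
        · simp
        · simp at hgood
      have key : ∀ z ∈ S, (F z).take (s' ++ [k']).length = treeMap F (s' ++ [k']) → z = s' := by
        intro z hz hzt
        exact (List.eq_of_take_eq_of_length_lt
          ((h.take_iff s' hs' z hz _).1 (e.symm.trans hzt.symm)) (by simp)).symm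
      exact hvx ((key v hv hvt).trans (key x hx hxt).symm)

theorem treeMap_surjOn (hF : ∀ t ∈ T, ∃ s ∈ S, F s = t) : Set.SurjOn (treeMap F) S T := by
  intro t
  induction t using List.reverseRecOn with
  | nil =>
    intro ht
    obtain ⟨s, hs, -⟩ := hF _ ht
    exact ⟨[], h.left s hs _ List.nil_prefix, treeMap_nil F⟩
  | append_singleton t j ih =>
    intro ht
    obtain ⟨s, hs, rfl⟩ := ih (h.right _ ht _ (List.prefix_append _ _))
    obtain ⟨k, hk, e⟩ := h.exists_treeMap_concat_eq hF hs ht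
    exact ⟨_, hk, e⟩

end IsTreeIsometry

/-! ### Vertices of a rooted tree as paths from the root -/

namespace RootedCombTree

variable (G H : RootedCombTree)

/-- The vertex of `G` at the end of the path `s`. -/
def endpoint (s : List ℕ) : ℕ := (G.root :: s).getLast (List.cons_ne_nil _ _)

theorem endpoint_concat (s : List ℕ) (k : ℕ) : G.endpoint (s ++ [k]) = k := by
  simp [endpoint, List.getLast_cons]

theorem nil_mem_sequences : [] ∈ G.sequences := by simp [sequences]

variable {G H}

theorem mem_sequences_of_prefix {s t : List ℕ} (hs : s ∈ G.sequences) (h : t <+: s) :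
    t ∈ G.sequences := by
  have h' : G.root :: t <+: G.root :: s := by simpa using h
  exact ⟨hs.1.prefix h', hs.2.sublist h'.sublist⟩

theorem exists_walk {s : List ℕ} (hs : s ∈ G.sequences) :
    ∃ p : G.graph.Walk G.root (G.endpoint s), p.IsPath ∧ p.support = G.root :: s :=
  ⟨SimpleGraph.Walk.ofSupport (G.root :: s) (List.cons_ne_nil _ _) hs.1,
    (SimpleGraph.Walk.isPath_def _).2
      ((SimpleGraph.Walk.support_ofSupport (List.cons_ne_nil _ _) hs.1).symm ▸ hs.2),
    SimpleGraph.Walk.support_ofSupport _ _⟩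

theorem exists_endpoint_eq (v : ℕ) : ∃ s ∈ G.sequences, G.endpoint s = v := by
  obtain ⟨p, hp, -⟩ := SimpleGraph.IsTree.existsUnique_path (G := G.graph) G.2 G.root v
  have e : G.root :: p.support.tail = p.support := p.cons_tail_support
  refine ⟨p.support.tail, ⟨?_, ?_⟩, ?_⟩
  · rw [e]; exact p.isChain_adj_support
  · rw [e]; exact hp.support_nodup
  · simp [endpoint, e]

theorem endpoint_injOn : Set.InjOn G.endpoint G.sequences := by
  intro s hs t ht e
  obtain ⟨p, hp, hps⟩ := exists_walk hs
  obtain ⟨q, hq, hqt⟩ := exists_walk ht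
  generalize G.endpoint s = v at *
  subst e
  have := congrArg SimpleGraph.Walk.support
    ((SimpleGraph.IsTree.existsUnique_path (G := G.graph) G.2 G.root _).unique hp hq)
  rw [hps, hqt] at this
  simpa using this

theorem adj_endpoint {s : List ℕ} {k : ℕ} (hk : s ++ [k] ∈ G.sequences) :
    G.graph.Adj (G.endpoint s) (G.endpoint (s ++ [k])) := by
  have := hk.1
  rw [← List.cons_append, List.isChain_append] at this
  rw [endpoint_concat]
  exact this.2.2 _ (by simp [endpoint, List.getLast?_eq_some_getLast]) _ (by simp)

/-- In an acyclic graph, of the paths from the root to two adjacent vertices, one is the other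
prolonged by the edge between them. -/
theorem eq_concat_of_adj {s t : List ℕ} (hs : s ∈ G.sequences) (ht : t ∈ G.sequences)
    (h : G.graph.Adj (G.endpoint s) (G.endpoint t)) : (∃ k, t = s ++ [k]) ∨ ∃ k, s = t ++ [k] := by
  obtain ⟨p, hp, hps⟩ := exists_walk hs
  obtain ⟨q, hq, hqt⟩ := exists_walk ht
  have hac : G.graph.IsAcyclic := G.2.isAcyclic
  by_cases hm : G.endpoint s ∈ q.support
  · left
    have := congrArg SimpleGraph.Walk.support (hac.path_concat hp hq h hm)
    rw [SimpleGraph.Walk.support_concat, hps, hqt] at this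
    exact ⟨_, by simpa using this⟩
  · right
    have hm' := hac.mem_support_of_ne_mem_support_of_adj_of_isPath hp hq h hm
    have := congrArg SimpleGraph.Walk.support (hac.path_concat hq hp h.symm hm')
    rw [SimpleGraph.Walk.support_concat, hps, hqt] at this
    exact ⟨_, by simpa using this⟩

theorem map_mem_sequences (f : G.graph ↪g H.graph) (hf : f G.root = H.root) {s : List ℕ}
    (hs : s ∈ G.sequences) : s.map f ∈ H.sequences := by
  have e : H.root :: s.map f = (G.root :: s).map f := by rw [List.map_cons, hf]
  refine ⟨?_, ?_⟩
  · rw [e, List.isChain_map]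
    exact hs.1.imp fun a b h => f.map_rel_iff.2 h
  · rw [e]
    exact hs.2.map f.injective

/-- Vertices correspond to sequences by unique paths, and adjacency to extension by one entry. Since
`treeMap F` is injective and respects one-entry extensions, it also reflects them, hence preserves
and reflects adjacency. -/
theorem exists_embedding {F : List ℕ → List ℕ} (hF : IsTreeIsometry G.sequences H.sequences F) :
    ∃ f : G.graph ↪g H.graph, f G.root = H.root ∧
      ∀ s ∈ G.sequences, f (G.endpoint s) = H.endpoint (treeMap F s) := by
  choose path hpath hend using fun v => exists_endpoint_eq (G := G) v
  have hpe : ∀ s ∈ G.sequences, path (G.endpoint s) = s := fun s hs =>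
    endpoint_injOn (hpath _) hs (hend _)
  let f : ℕ → ℕ := fun v => H.endpoint (treeMap F (path v))
  have hinj : Function.Injective f := by
    intro v w e
    have := endpoint_injOn (hF.treeMap_mem (hpath v)) (hF.treeMap_mem (hpath w)) e
    rw [← hend v, hF.treeMap_injOn (hpath v) (hpath w) this, hend]
  have hadj : ∀ s k, s ++ [k] ∈ G.sequences →
      H.graph.Adj (H.endpoint (treeMap F s)) (H.endpoint (treeMap F (s ++ [k]))) := by
    intro s k hk
    obtain ⟨j, hj⟩ := hF.exists_treeMap_concat hk
    have hm := hF.treeMap_mem hk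
    rw [hj] at hm ⊢
    exact adj_endpoint hm
  have hcon : ∀ s t, s ∈ G.sequences → t ∈ G.sequences →
      (∃ j, treeMap F t = treeMap F s ++ [j]) → ∃ k, t = s ++ [k] := by
    rintro s t hs ht ⟨j, hj⟩
    rcases List.eq_nil_or_concat' t with rfl | ⟨t, k, rfl⟩
    · simp [treeMap_nil] at hj
    · obtain ⟨j', hj'⟩ := hF.exists_treeMap_concat ht
      rw [hj'] at hj
      have := hF.treeMap_injOn (hF.mem_of_concat ht) hs (List.append_inj_left' hj rfl)
      exact ⟨k, by rw [this]⟩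
  refine ⟨⟨⟨f, hinj⟩, fun {v w} => ?_⟩, ?_, fun s hs => ?_⟩
  · change H.graph.Adj (f v) (f w) ↔ G.graph.Adj v w
    have hv := hpath v
    have hw := hpath w
    constructor
    · intro h
      rw [← hend v, ← hend w]
      rcases eq_concat_of_adj (hF.treeMap_mem hv) (hF.treeMap_mem hw) h with h | h
      · obtain ⟨k, hk⟩ := hcon _ _ hv hw h
        rw [hk] at hw ⊢
        exact adj_endpoint hw
      · obtain ⟨k, hk⟩ := hcon _ _ hw hv h
        rw [hk] at hv ⊢
        exact (adj_endpoint hv).symm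
    · intro h
      rw [← hend v, ← hend w] at h
      change H.graph.Adj (H.endpoint (treeMap F (path v))) (H.endpoint (treeMap F (path w)))
      rcases eq_concat_of_adj hv hw h with ⟨k, hk⟩ | ⟨k, hk⟩
      · rw [hk] at hw ⊢
        exact hadj _ _ hw
      · rw [hk] at hv ⊢
        exact (hadj _ _ hv).symm
  · have := hpe [] G.nil_mem_sequences
    change H.endpoint (treeMap F (path (G.endpoint []))) = H.endpoint []
    rw [this, treeMap_nil]
  · change H.endpoint (treeMap F (path (G.endpoint s))) = _
    rw [hpe s hs]

theorem exists_iso {F : List ℕ → List ℕ} (hF : IsTreeIsometry G.sequences H.sequences F)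
    (hs : ∀ t ∈ H.sequences, ∃ s ∈ G.sequences, F s = t) : G.Isomorphic H := by
  obtain ⟨f, hf, hfe⟩ := exists_embedding hF
  have hsurj : Function.Surjective f := by
    intro v
    obtain ⟨t, ht, rfl⟩ := exists_endpoint_eq (G := H) v
    obtain ⟨s, hs, rfl⟩ := hF.treeMap_surjOn hs ht
    exact ⟨_, hfe s hs⟩
  exact ⟨⟨Equiv.ofBijective f ⟨f.injective, hsurj⟩, f.map_rel_iff⟩, hf⟩

theorem measurableSet_mem_sequences (s : List ℕ) :
    MeasurableSet {G : RootedCombTree | s ∈ G.sequences} := by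
  have hroot : Measurable root := measurable_snd.comp measurable_subtype_coe
  have hgraph : Measurable graph := measurable_fst.comp measurable_subtype_coe
  have : {G : RootedCombTree | s ∈ G.sequences} = ⋃ k, {G : RootedCombTree | root G = k} ∩
      graph ⁻¹' {g | (k :: s).IsChain g.Adj ∧ (k :: s).Nodup} := by
    ext G
    simp [sequences]
  rw [this]
  refine MeasurableSet.iUnion fun k => (hroot (measurableSet_singleton k)).inter (hgraph ?_)
  refine MeasurableSet.inter ?_ (MeasurableSet.const _)
  generalize k :: s = l
  induction l using List.twoStepInduction with
  | nil => simp only [List.isChain_nil]; exact MeasurableSet.const True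
  | singleton a => simp only [List.isChain_singleton]; exact MeasurableSet.const True
  | cons_cons a b l _ ih =>
    simp only [List.isChain_cons_cons]
    exact MeasurableSet.inter (measurableSet_setOfPred.2 (by fun_prop)) (ih b)

end RootedCombTree

/-! ### The spaces of sequences attached to rooted trees -/

section TreeSpaces

variable {r : ℕ → ℝ} {ρ : List ℕ → UrysohnSpace}

theorem exists_isSequenceEmbedding (hr : StrictAnti r) (h0 : ∀ n, 0 < r n) :
    ∃ ρ : List ℕ → UrysohnSpace, IsSequenceEmbedding r ρ :=
  UrysohnConstruction.exists_dist_eq (sequenceDist r) sequenceDist_self sequenceDist_comm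
    fun a b c => (sequenceDist_le_max hr h0 a b c).trans
      (max_le_add_of_nonneg (sequenceDist_nonneg h0 _ _) (sequenceDist_nonneg h0 _ _))

/-- Distinct points are at distance at least `r₀ > 0`, so every subset of the image is closed. This
is the role of the positive limit. -/
theorem IsSequenceEmbedding.isClosed_image (hρ : IsSequenceEmbedding r ρ) {r₀ : ℝ} (hr₀ : 0 < r₀)
    (h : ∀ n, r₀ ≤ r n) (S : Set (List ℕ)) : IsClosed (ρ '' S) := by
  refine Metric.isClosed_of_pairwise_le_dist hr₀ ?_
  rintro _ ⟨s, -, rfl⟩ _ ⟨t, -, rfl⟩ hne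
  have hst : s ≠ t := fun e => hne (congrArg ρ e)
  obtain ⟨n, hn, -⟩ := exists_sequenceDist_eq (r := r) hst
  rw [hρ, hn]
  exact h n

theorem RootedCombTree.exists_isTreeIsometry (hr : StrictAnti r) (h0 : ∀ n, 0 < r n)
    (hρ : IsSequenceEmbedding r ρ) {G H : RootedCombTree}
    (f : ρ '' G.sequences → ρ '' H.sequences) (hf : Isometry f) :
    ∃ F, IsTreeIsometry G.sequences H.sequences F ∧
      ∀ s (hs : s ∈ G.sequences), ρ (F s) = f ⟨ρ s, s, hs, rfl⟩ := by
  have ex : ∀ s, ∃ t, ∀ hs : s ∈ G.sequences, t ∈ H.sequences ∧ ρ t = f ⟨ρ s, s, hs, rfl⟩ := by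
    intro s
    by_cases hs : s ∈ G.sequences
    · obtain ⟨t, ht, e⟩ := (f ⟨ρ s, s, hs, rfl⟩).2
      exact ⟨t, fun _ => ⟨ht, e⟩⟩
    · exact ⟨[], fun h => absurd h hs⟩
  choose F hF using ex
  have hd : ∀ s ∈ G.sequences, ∀ t ∈ G.sequences,
      sequenceDist r (F s) (F t) = sequenceDist r s t := by
    intro s hs t ht
    rw [← hρ, ← hρ, (hF s hs).2, (hF t ht).2]
    exact hf.dist_eq ⟨ρ s, s, hs, rfl⟩ ⟨ρ t, t, ht, rfl⟩
  refine ⟨F, ⟨fun s hs t h => mem_sequences_of_prefix hs h,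
    fun s hs t h => mem_sequences_of_prefix hs h, fun s hs => (hF s hs).1, fun s hs t ht n => ?_,
    fun s hs t ht e => ?_⟩, fun s hs => (hF s hs).2⟩
  · rw [← sequenceDist_le_iff hr h0, hd s hs t ht, sequenceDist_le_iff hr h0]
  · rw [← sequenceDist_eq_zero h0, ← hd s hs t ht, e, sequenceDist_self]

theorem RootedCombTree.isomorphic_iff (hr : StrictAnti r) (h0 : ∀ n, 0 < r n)
    (hρ : IsSequenceEmbedding r ρ) {G H : RootedCombTree} :
    G.Isomorphic H ↔ Nonempty (ρ '' G.sequences ≃ᵢ ρ '' H.sequences) := by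
  constructor
  · rintro ⟨e, he⟩
    have hinv : e.symm H.root = G.root := by rw [← he, e.symm_apply_apply]
    have hG := fun s (hs : s ∈ G.sequences) => map_mem_sequences e.toEmbedding he hs
    have hH := fun s (hs : s ∈ H.sequences) => map_mem_sequences e.symm.toEmbedding hinv hs
    let E : G.sequences ≃ H.sequences :=
      ⟨fun s => ⟨s.1.map e, hG s s.2⟩, fun s => ⟨s.1.map e.symm, hH s s.2⟩,
        fun s => Subtype.ext (by simp [Function.comp_def]),
        fun s => Subtype.ext (by simp [Function.comp_def])⟩
    have hinj : Function.Injective ρ := fun s t h => by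
      rw [← sequenceDist_eq_zero h0, ← hρ, h, dist_self]
    refine ⟨⟨(Equiv.Set.image ρ _ hinj).symm.trans (E.trans (Equiv.Set.image ρ _ hinj)),
      Isometry.of_dist_eq ?_⟩⟩
    intro x y
    obtain ⟨s, rfl⟩ := (Equiv.Set.image ρ G.sequences hinj).surjective x
    obtain ⟨t, rfl⟩ := (Equiv.Set.image ρ G.sequences hinj).surjective y
    simp only [Equiv.toFun_as_coe, Equiv.trans_apply, Equiv.symm_apply_apply]
    change dist (ρ (s.1.map e)) (ρ (t.1.map e)) = dist (ρ s) (ρ t)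
    rw [hρ, hρ, sequenceDist_map e.injective]
  · rintro ⟨f⟩
    obtain ⟨F, hF, hFf⟩ := exists_isTreeIsometry hr h0 hρ f f.isometry
    refine exists_iso hF fun t ht => ?_
    obtain ⟨⟨_, s, hs, rfl⟩, h⟩ := f.surjective ⟨ρ t, t, ht, rfl⟩
    refine ⟨s, hs, ?_⟩
    rw [← sequenceDist_eq_zero h0, ← hρ, hFf s hs, h, dist_self]

theorem RootedCombTree.embeds_iff (hr : StrictAnti r) (h0 : ∀ n, 0 < r n)
    (hρ : IsSequenceEmbedding r ρ) {G H : RootedCombTree} :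
    G.Embeds H ↔ ∃ f : ρ '' G.sequences → ρ '' H.sequences, Isometry f := by
  constructor
  · rintro ⟨e, he⟩
    choose s hs hsx using fun x : ρ '' G.sequences => x.2
    refine ⟨fun x => ⟨ρ ((s x).map e), _, map_mem_sequences e he (hs x), rfl⟩,
      Isometry.of_dist_eq fun x y => ?_⟩
    change dist (ρ _) (ρ _) = dist x.1 y.1
    rw [hρ, sequenceDist_map e.injective, ← hρ, hsx, hsx]
  · rintro ⟨f, hf⟩
    obtain ⟨F, hF, -⟩ := exists_isTreeIsometry hr h0 hρ f hf
    obtain ⟨e, he, -⟩ := exists_embedding hF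
    exact ⟨e, he⟩

end TreeSpaces

/-! ### Assembling the reductions -/

theorem uSpacesStar_subset_uSpaces (D : Set ℝ) : USpacesStar D ⊆ USpaces D :=
  fun _ h => ⟨h.1, h.2.le⟩

theorem mainTheorem1 (D : Set ℝ) (hD : D.Countable) (hD_nonneg : ∀ r ∈ D, 0 ≤ r)
    (hD_zero : (0 : ℝ) ∈ D) (r : ℕ → ℝ) (hr : StrictAnti r) (hrD : ∀ n, r n ∈ D) :
    -- isometry on the spaces with distances in `D`
    BorelBireducible (fun U V : USpaces D => IsometricSpaces U V) GraphIsomorphism ∧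
    -- isometry on the spaces with distance set exactly `D`
    BorelBireducible (fun U V : USpacesStar D => IsometricSpaces U V) GraphIsomorphism ∧
    -- the map `θ`, when the limit of the sequence is positive
    (∀ r₀ : ℝ, 0 < r₀ → Filter.Tendsto r Filter.atTop (nhds r₀) →
      (∃ ρ : List ℕ → UrysohnSpace, IsSequenceEmbedding r ρ) ∧
      ∀ ρ : List ℕ → UrysohnSpace, IsSequenceEmbedding r ρ →
        ∃ θ : RootedCombTree → USpaces D,
          (∀ G, (θ G : NonemptyClosed UrysohnSpace).carrier = ρ '' G.sequences) ∧
          Measurable θ ∧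
          (∀ G H, G.Isomorphic H ↔ IsometricSpaces (θ G) (θ H)) ∧
          (∀ G H, G.Embeds H ↔ IsometricallyEmbeds (θ G) (θ H))) := by
  have h0 : ∀ n, 0 < r n := hr.pos_of_forall_mem hD_nonneg hrD
  have hincl : Measurable (Set.inclusion (uSpacesStar_subset_uSpaces D)) :=
    measurable_inclusion _
  obtain ⟨f, hf, hfi⟩ := borelReducible_graphIsomorphism_uSpacesStar hD hD_nonneg hD_zero hr hrD
  obtain ⟨g, hg, hgi⟩ := borelReducible_uSpaces_graphIsomorphism D
  -- Both bireductions use the same two maps, composed with the inclusion of `USpacesStar D` in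
  -- `USpaces D`.
  refine ⟨⟨⟨g, hg, hgi⟩, _, hincl.comp hf, fun x x' => hfi x x'⟩,
    ⟨⟨_, hg.comp hincl, fun U V => hgi (Set.inclusion (uSpacesStar_subset_uSpaces D) U)
      (Set.inclusion (uSpacesStar_subset_uSpaces D) V)⟩, f, hf, hfi⟩,
    fun r₀ hr₀ hlim => ⟨exists_isSequenceEmbedding hr h0, fun ρ hρ => ?_⟩⟩
  have hclosed : ∀ S, closure (ρ '' S) = ρ '' S := fun S =>
    (hρ.isClosed_image hr₀ (fun n => hr.antitone.le_of_tendsto hlim n) S).closure_eq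
  have hne : ∀ G : RootedCombTree, G.sequences.Nonempty := fun G => ⟨[], G.nil_mem_sequences⟩
  have hu : ∀ G : RootedCombTree, ∀ x ∈ ρ '' G.sequences, ∀ y ∈ ρ '' G.sequences,
      ∀ z ∈ ρ '' G.sequences, dist x z ≤ max (dist x y) (dist y z) := by
    rintro G _ ⟨s, -, rfl⟩ _ ⟨t, -, rfl⟩ _ ⟨u, -, rfl⟩
    rw [hρ, hρ, hρ]
    exact sequenceDist_le_max hr h0 _ _ _
  -- The map is written with a closure so that the general measurability lemma applies; by `hclosed`
  -- the closure adds nothing.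
  refine ⟨fun G => ⟨NonemptyClosed.closure (ρ '' G.sequences) ((hne G).image ρ),
    isUltrametricDist_closure _ (hu G), ?_⟩, fun G => hclosed _,
    (NonemptyClosed.measurable_closure_image ρ hne
      RootedCombTree.measurableSet_mem_sequences).subtype_mk, fun G H => ?_, fun G H => ?_⟩
  · rw [distanceSet_closure _ (hu G)]
    rintro _ ⟨_, ⟨s, -, rfl⟩, _, ⟨t, -, rfl⟩, rfl⟩
    rw [hρ]
    exact sequenceDist_mem hD_zero hrD s t
  · change _ ↔ Nonempty (closure (ρ '' G.sequences) ≃ᵢ closure (ρ '' H.sequences))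
    rw [hclosed, hclosed, RootedCombTree.isomorphic_iff hr h0 hρ]
  · change _ ↔ ∃ f : closure (ρ '' G.sequences) → closure (ρ '' H.sequences), Isometry f
    rw [hclosed, hclosed, RootedCombTree.embeds_iff hr h0 hρ]
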